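/- Let $n,m\ge 0$ be integers, $f:\{0,1\}^n\to\mathbb R$, $H=(h_1,\dots,h_m):\{0,1\}^n\to\mathbb R^m$, $b\in\mathbb R^m$, $M>0$ and $S=[-M,M]^m$. Put $L(x,\lambda)=f(x)+\lambda^{T}(H(x)-b)$, $g(\lambda)=\min_{x\in\{0,1\}^n}L(x,\lambda)$, $g_X(\lambda)=\min_{x\in X}L(x,\lambda)$ for $\emptyset\ne X\subseteq\{0,1\}^n$, and $\chi_g=\bigcup_{\lambda\in\mathbb R^m}\operatorname{argmin}_{x}L(x,\lambda)$. Let $P_x=\{(\lambda,z)\in\mathbb R^{m+1}: z=L(x,\lambda)\}$ and $P_x(\lambda)=L(x,\lambda)$; write points of $\mathbb R^{m+1}$ as $u=(\lambda_u,z_u)$. **Skeleton.** A point $y$ is a proper convex combination of $\{y_1,\dots,y_k\}$ if $y=\sum_i\alpha_iy_i$ with all $\alpha_i\in(0,1)$ and $\sum_i\alpha_i=1$. For a convex set $C\subseteq\mathbb R^{m+1}$, a vertex of $C$ is a $v\in C$ such that $v$ is a proper convex combination of $U\subseteq C$ only if $U=\{v\}$; a bounded edge of $C$ is a segment $e(u,v)$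 joining two distinct vertices $u,v$ of $C$ such that whenever some $y\in e(u,v)$ is a proper convex combination of $W\subseteq C$, then $W\subseteq e(u,v)$. For $G=g$ or $G=g_X$ let $\Gamma=\{q:\lambda_q\in S,\ z_q\le G(\lambda_q)\}$. The skeleton $\mathcal G_G=(\mathcal V_G,\mathcal E_G)$ of $G$ over $S$ consists of the set $\mathcal V_G$ of vertices of $\Gamma$ and the set $\mathcal E_G$ of bounded edges of $\Gamma$ together with the vertical rays $e(u,(\lambda_u,-\infty))=\{(\lambda_u,z):z\le z_u\}$ for $u\in\mathcal V_G$ with $\lambda_u\in\{-M,M\}^m$. For a finite set $W$, $ConvEdge(W)$ is the set of bounded edges of the convex hull of $W$. **DualSearch.** Let $\mathcal O$ be an oracle with $\mathcal O(\lambda)\in\operatorname{argmin}_xL(x,\lambda)$ for every $\lambda\in S$. Start with $x_0=\mathcal O(\lambda_0)$ for an arbitrary $\lambda_0\in\{-M,M\}^m$, $X=\{x_0\}$, $\mathcal V=\{(\lambda,P_{x_0}(\lambda)):\lambda\in\{-M,M\}^m\}$ in an arbitrary order, and $\mathcal E=\mathcal E_{g_X}$. As long as there are unprocessed elements of the ordered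 set $\mathcal V$, take the first one, $v$, mark it as processed and let $x_v=\mathcal O(\lambda_v)$. If $P_{x_v}(\lambda_v)<z_v$, do the following: - replace $X$ by $X\cup\{x_v\}$; - append to $\mathcal V$, in arbitrary order, those points of $\mathcal V^+=\{u\in P_{x_v}\cap e: e\in\mathcal E,\ e\not\subseteq P_{x_v}\}$ that are not already in $\mathcal V$; - remove $\mathcal V^-=\{u\in\mathcal V: z_u>P_{x_v}(\lambda_u)\}$ from $\mathcal V$; - replace $\mathcal E$ by $(\mathcal E\cup ConvEdge(\mathcal V^+)\cup\mathcal E^+)\setminus\mathcal E^-$. Here $\mathcal E^-$ is the set of edges in $\mathcal E$ with an endpoint in $\mathcal V^-$, and $\mathcal E^+$ is the set of all $e(u_1,u_3)$ such that $e(u_1,u_2)\in\mathcal E^-$, $u_1\notin\mathcal V^-$ (possibly $u_1$ is an endpoint at $-\infty$), $e(u_1,u_2)\cap P_{x_v}=\{u_3\}$ and $u_3\ne u_1$. The algorithm terminates when every element of $\mathcal V$ has been processed. **Claim.** Whenever DualSearch terminates (for any choice of $\mathcal O$, of $\lambda_0$ and of the arbitrary orders), the graph $\mathcal G=(\mathcal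 V,\mathcal E)$ that it maintains satisfies $\mathcal G=\mathcal G_g$, and also $\mathcal G=\mathcal G_{g_{\chi_g}}$; that is, $\mathcal G$ is the skeleton over $S$ of the full dual $g$ and of the dual induced on $\chi_g$. -/

import Mathlib

namespace DualSearch

/-- The data of the constrained problem `min {f x : h i x = b i, i = 1, …, m}` over `x ∈ {0,1}ⁿ`. -/
structure Problem (n m : ℕ) where
  f : (Fin n → Bool) → ℝ
  h : Fin m → (Fin n → Bool) → ℝ
  b : Fin m → ℝ

/-- Points `q = (λ_q, z_q)` of `ℝ^{m+1}`; `q.1` is `λ_q` and `q.2` is `z_q`. -/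
abbrev Point (m : ℕ) : Type := (Fin m → ℝ) × ℝ

section Dual

variable {n m : ℕ} (p : Problem n m)

/-- The Lagrangian `L(x, λ) = f(x) + λᵀ (H(x) - b)`. -/
def lagrangian (x : Fin n → Bool) (l : Fin m → ℝ) : ℝ :=
  p.f x + ∑ i, l i * (p.h i x - p.b i)

/-- `argmin_{x ∈ {0,1}ⁿ} L(x, λ)`, the set of all minimizers. -/
def argminSet (l : Fin m → ℝ) : Set (Fin n → Bool) :=
  {x | ∀ y, lagrangian p x l ≤ lagrangian p y l}

/-- The characteristic set `χ_g`. -/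
def charSet : Set (Fin n → Bool) := ⋃ l : Fin m → ℝ, argminSet p l

/-- The dual `g(λ) = min_{x ∈ {0,1}ⁿ} L(x, λ)`. -/
noncomputable def dual (l : Fin m → ℝ) : ℝ := ⨅ x : Fin n → Bool, lagrangian p x l

/-- The induced dual `g_X(λ) = min_{x ∈ X} L(x, λ)` (meaningful for nonempty `X`). -/
noncomputable def inducedDual (X : Set (Fin n → Bool)) (l : Fin m → ℝ) : ℝ :=
  ⨅ x : X, lagrangian p x.1 l

/-- The infimum in `dual` is an attained minimum. -/
theorem dual_isLeast (l : Fin m → ℝ) :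
    IsLeast (Set.range fun x => lagrangian p x l) (dual p l) := by
  refine ⟨?_, ?_⟩
  · obtain ⟨x, hx⟩ := exists_eq_ciInf_of_finite (f := fun x => lagrangian p x l)
    exact ⟨x, hx⟩
  · rintro _ ⟨x, rfl⟩
    exact ciInf_le (Set.finite_range _).bddBelow x

/-- For nonempty `X` the infimum in `inducedDual` is an attained minimum. -/
theorem inducedDual_isLeast {X : Set (Fin n → Bool)} (hX : X.Nonempty) (l : Fin m → ℝ) :
    IsLeast ((fun x => lagrangian p x l) '' X) (inducedDual p X l) := by
  have : Nonempty X := hX.to_subtype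
  refine ⟨?_, ?_⟩
  · obtain ⟨x, hx⟩ := exists_eq_ciInf_of_finite (f := fun x : X => lagrangian p x.1 l)
    exact ⟨x.1, x.2, hx⟩
  · rintro _ ⟨x, hx, rfl⟩
    exact ciInf_le (f := fun x : X => lagrangian p x.1 l)
      (Set.finite_range _).bddBelow ⟨x, hx⟩

/-- The characteristic set is nonempty. -/
theorem charSet_nonempty : (charSet p).Nonempty := by
  obtain ⟨x, hx⟩ := Finite.exists_min (fun x => lagrangian p x 0)
  exact ⟨x, Set.mem_iUnion.2 ⟨0, hx⟩⟩

/-- The hyperplane `P_x = {(λ, z) : z = L(x, λ)}`; so `P_x(λ)` is `lagrangian p x λ`. -/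
def hyperplane (x : Fin n → Bool) : Set (Point m) := {q | q.2 = lagrangian p x q.1}

end Dual

section Skeleton

variable {m : ℕ}

/-- `x` is a proper convex combination of the finite set `U = {x_1, …, x_k}`: `x = ∑ α_i x_i`
with all `α_i ∈ (0,1)` and `∑ α_i = 1`. -/
def IsProperConvComb (x : Point m) (U : Set (Point m)) : Prop :=
  ∃ (k : ℕ) (y : Fin k → Point m) (a : Fin k → ℝ),
    (∀ i, a i ∈ Set.Ioo (0 : ℝ) 1) ∧ ∑ i, a i = 1 ∧ Set.range y = U ∧ x = ∑ i, a i • y i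

/-- The vertices of a convex set `C`. -/
def vertices (C : Set (Point m)) : Set (Point m) :=
  {v | v ∈ C ∧ ∀ U ⊆ C, IsProperConvComb v U → U = {v}}

/-- The bounded edges of a convex set `C`, each edge `e(u,v)` (with `u ≠ v`) being identified
with the line segment it is. -/
def segmentEdges (C : Set (Point m)) : Set (Set (Point m)) :=
  {e | ∃ u ∈ vertices C, ∃ v ∈ vertices C, u ≠ v ∧ e = segment ℝ u v ∧
    ∀ y ∈ e, ∀ W ⊆ C, IsProperConvComb y W → W ⊆ e}

/-- The edge `e(u, (λ_u, -∞))`: the vertical ray going down from `u`. -/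
def downRay (u : Point m) : Set (Point m) := {q | q.1 = u.1 ∧ q.2 ≤ u.2}

/-- The box `S = [-M, M]^m`. -/
def box (m : ℕ) (M : ℝ) : Set (Fin m → ℝ) := {l | ∀ i, l i ∈ Set.Icc (-M) M}

/-- The corners `{-M, M}^m` of the box. -/
def corners (m : ℕ) (M : ℝ) : Set (Fin m → ℝ) := {l | ∀ i, l i = -M ∨ l i = M}

/-- `Γ(S) = {q : λ_q ∈ S, z_q ≤ G(λ_q)}` for a function `G` (a dual or an induced dual). -/
def hypograph (M : ℝ) (G : (Fin m → ℝ) → ℝ) : Set (Point m) :=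
  {q | q.1 ∈ box m M ∧ q.2 ≤ G q.1}

/-- The vertex set of the skeleton of `G` over `S`. -/
def skeletonVertices (M : ℝ) (G : (Fin m → ℝ) → ℝ) : Set (Point m) :=
  vertices (hypograph M G)

/-- The edge set of the skeleton of `G` over `S`. -/
def skeletonEdges (M : ℝ) (G : (Fin m → ℝ) → ℝ) : Set (Set (Point m)) :=
  segmentEdges (hypograph M G) ∪
    {e | ∃ u ∈ skeletonVertices M G, u.1 ∈ corners m M ∧ e = downRay u}

/-- The skeleton of `G` over `S`, as the pair (vertex set, edge set). -/
def skeleton (M : ℝ) (G : (Fin m → ℝ) → ℝ) : Set (Point m) × Set (Set (Point m)) :=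
  (skeletonVertices M G, skeletonEdges M G)

/-- `ConvEdge(W)`: the edges of the convex hull of `W`. -/
def convEdge (W : Set (Point m)) : Set (Set (Point m)) := segmentEdges (convexHull ℝ W)

end Skeleton

section Algorithm

variable {n m : ℕ}

/-- A state of the algorithm. The ordered vertex collection `V` is the list `processed ++ pending`:
first the vertices of `V` already treated by the loop, then those still to be treated. -/
structure State (n m : ℕ) where
  X : Set (Fin n → Bool)
  processed : List (Point m)
  pending : List (Point m)
  E : Set (Set (Point m))

/-- The vertex set `V` of a state. -/
def State.V (s : State n m) : Set (Point m) := {u | u ∈ s.processed ++ s.pending}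

/-- The graph maintained by the algorithm, as the pair (vertex set, edge set). -/
def State.graph (s : State n m) : Set (Point m) × Set (Set (Point m)) := (s.V, s.E)

variable (p : Problem n m)

/-- `V⁺ = {u ∈ P_x ∩ e : e ∈ E, e ⊄ P_x}`. -/
def newVertices (x : Fin n → Bool) (E : Set (Set (Point m))) : Set (Point m) :=
  {u | ∃ e ∈ E, ¬ e ⊆ hyperplane p x ∧ u ∈ hyperplane p x ∩ e}

/-- `V⁻ = {u ∈ V : z_u > P_x(λ_u)}`. -/
def cutVertices (x : Fin n → Bool) (V : Set (Point m)) : Set (Point m) :=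
  {u | u ∈ V ∧ lagrangian p x u.1 < u.2}

/-- `E⁻`: the edges in `E` that have an end point in `V⁻`. -/
def cutEdges (Vminus : Set (Point m)) (E : Set (Set (Point m))) : Set (Set (Point m)) :=
  {e | e ∈ E ∧
    ((∃ u₁ u₂, e = segment ℝ u₁ u₂ ∧ (u₁ ∈ Vminus ∨ u₂ ∈ Vminus)) ∨
      ∃ u ∈ Vminus, e = downRay u)}

/-- `E⁺`: what remains of the edges in `E⁻` below the hyperplane. An edge `e(u₁,u₂)` whose end
point `u₁` survives leaves `e(u₁,u₃)`, where `u₃` is its intersection with `P_x`, unless this is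
the single point `u₁ = u₃`; a ray from `u` leaves the ray from its intersection with `P_x`. -/
def shortenedEdges (x : Fin n → Bool) (Vminus : Set (Point m)) (Eminus : Set (Set (Point m))) :
    Set (Set (Point m)) :=
  {e | ∃ u₁ u₂ u₃, segment ℝ u₁ u₂ ∈ Eminus ∧ u₁ ∉ Vminus ∧
      segment ℝ u₁ u₂ ∩ hyperplane p x = {u₃} ∧ u₁ ≠ u₃ ∧ e = segment ℝ u₁ u₃} ∪
  {e | ∃ u u₃, downRay u ∈ Eminus ∧ downRay u ∩ hyperplane p x = {u₃} ∧ e = downRay u₃}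

/-- The updated edge set `E ∪ ConvEdge(V⁺) ∪ E⁺ - E⁻`. -/
def updatedEdges (x : Fin n → Bool) (V : Set (Point m)) (E : Set (Set (Point m))) :
    Set (Set (Point m)) :=
  (E ∪ convEdge (newVertices p x E) ∪
      shortenedEdges p x (cutVertices p x V) (cutEdges (cutVertices p x V) E)) \
    cutEdges (cutVertices p x V) E

open Classical in
/-- Deletion from an ordered list of all points strictly above `P_x`. -/
noncomputable def removeAbove (x : Fin n → Bool) (l : List (Point m)) : List (Point m) :=
  l.filter fun u => decide (u.2 ≤ lagrangian p x u.1)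

/-- `O` is an oracle for the dual on `S = [-M, M]^m`: it returns a minimizer of `L(·, λ)`. -/
def IsOracle (M : ℝ) (O : (Fin m → ℝ) → (Fin n → Bool)) : Prop :=
  ∀ l ∈ box m M, O l ∈ argminSet p l

/-- `s` is a possible result of the initialization: for some corner `λ₀` and `x₀ = O(λ₀)`, the
state has `X = {x₀}`, the vertices are the points of `P_{x₀}` above the corners, in an arbitrary
order and none of them treated yet, and the edges are those of the skeleton of `g_X`. -/
def IsInitial (M : ℝ) (O : (Fin m → ℝ) → (Fin n → Bool)) (s : State n m) : Prop :=
  ∃ l₀ ∈ corners m M,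
    s.X = {O l₀} ∧
    s.processed = [] ∧
    s.pending.Nodup ∧
    (∀ u, u ∈ s.pending ↔ u.1 ∈ corners m M ∧ u.2 = lagrangian p (O l₀) u.1) ∧
    s.E = skeletonEdges M (inducedDual p s.X)

/-- One iteration of the loop, for the first vertex `v` that is still to be treated. -/
inductive Step (O : (Fin m → ℝ) → (Fin n → Bool)) : State n m → State n m → Prop
  /-- The test `P_{x_v}(λ_v) < z_v` fails, so nothing changes but that `v` is now treated. -/
  | confirm (s : State n m) (v : Point m) (rest : List (Point m))
      (hv : s.pending = v :: rest)
      (htest : ¬ lagrangian p (O v.1) v.1 < v.2) :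
      Step O s ⟨s.X, s.processed ++ [v], rest, s.E⟩
  /-- The test succeeds: `X`, `V` and `E` are updated, where `new` lists in an arbitrary order
  those points of `V⁺` that are not in `V` already. -/
  | cut (s : State n m) (v : Point m) (rest new : List (Point m))
      (hv : s.pending = v :: rest)
      (htest : lagrangian p (O v.1) v.1 < v.2)
      (hnodup : new.Nodup)
      (hnew : ∀ u, u ∈ new ↔ u ∈ newVertices p (O v.1) s.E ∧ u ∉ s.V) :
      Step O s
        ⟨insert (O v.1) s.X,
         removeAbove p (O v.1) (s.processed ++ [v]),
         removeAbove p (O v.1) (rest ++ new),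
         updatedEdges p (O v.1) s.V s.E⟩

/-- The algorithm can terminate in the state `s`: `s` is reached from an initial state by finitely
many iterations, and no vertex is left to be treated. -/
def TerminatesIn (M : ℝ) (O : (Fin m → ℝ) → (Fin n → Bool)) (s : State n m) : Prop :=
  ∃ s₀, IsInitial p M O s₀ ∧ Relation.ReflTransGen (Step p O) s₀ s ∧ s.pending = []

end Algorithm

end DualSearch

/-! The proof is a loop invariant (`Invariant`): the graph is the skeleton of `g_X` over `S`, and
every processed vertex lies on or below the graph of `g`. At termination all vertices of the
polyhedron `Γ_X` are processed. If some point of `Γ_X` were above a hyperplane `P_x`, maximizing the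
height over `P_x` would give an extreme point of `Γ_X` above `P_x`, which is impossible
(`region_subset_of_vertices`). Hence `Γ_X = Γ_g`, and the skeleton depends only on this set. The
dual induced on `χ_g` is `g` itself.

The substance is that a cut preserves the invariant. Passing from `X` to `insert x X` intersects
`Γ_X` with the half-space below `P_x`. The vertices of the result are the old ones not above `P_x`,
together with the points where old edges cross `P_x` (`extremePoints_region_insert`). Its edges are
old edges that survive, old edges shortened at `P_x`, and edges of the new facet in `P_x`
(`updatedEdges_eq`). By Krein–Milman that facet is the convex hull of `V⁺`, so `ConvEdge(V⁺)`
supplies exactly its edges.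

Edges are found through two-sided directions: `e` such that both `y + e` and `y - e` lie in the
polyhedron. If these are the multiples of one nonzero vector, `y` lies on an edge
(`exists_edge_of_line`). A simplex-type argument (`exists_edge_direction`) shows that an old vertex
already on `P_x` starts an edge leaving `P_x`, so it too belongs to `V⁺`. -/

namespace DualSearch

/-! ### Extreme points and edge directions of polyhedra -/

section Convexity

variable {E : Type*} [AddCommGroup E] [Module ℝ E]

/-- If every direction in which one can move both ways from `y` inside `Q` is a multiple of `d`,
then the line through `y` along `d` meets `Q` in an extreme set. -/
theorem isExtreme_inter_line {Q : Set E} (hQ : Convex ℝ Q) {y d : E}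
    (h1 : y + d ∈ Q) (h2 : y - d ∈ Q)
    (hd : ∀ e, y + e ∈ Q → y - e ∈ Q → ∃ t : ℝ, e = t • d) :
    IsExtreme ℝ Q (Q ∩ {q | ∃ t : ℝ, q = y + t • d}) := by
  refine ⟨Set.inter_subset_left, ?_⟩
  rintro p hp q hq x ⟨hxQ, t, hxt⟩ ⟨a, b, ha, hb, hab, hx⟩
  refine ⟨hp, ?_⟩
  -- With `x = a • p + b • q`, a shift by `±(a * b) • (p - q)` stays on the segment from `p` to `q`,
  -- so it is a two-sided direction at `x`.
  have hw1 : x + (a * b) • (p - q) ∈ Q := by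
    have : x + (a * b) • (p - q) = (1 - a) • x + a • p := by
      rw [← hx]; obtain rfl : b = 1 - a := by linarith
      module
    rw [this]
    exact hQ hxQ hp (by linarith) ha.le (by ring)
  have hw2 : x - (a * b) • (p - q) ∈ Q := by
    have : x - (a * b) • (p - q) = (1 - b) • x + b • q := by
      rw [← hx]; obtain rfl : b = 1 - a := by linarith
      module
    rw [this]
    exact hQ hxQ hq (by linarith) hb.le (by ring)
  set w := (a * b) • (p - q) with hw
  have hpos : 0 < 2 + |t| := by positivity
  have hpos' : 0 < 1 + |t| := by positivity
  have habs := abs_le.1 (le_refl |t|)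
  have hx' : y - (t / (1 + |t|)) • d ∈ Q := by
    have : y - (t / (1 + |t|)) • d =
        ((1 - t / (1 + |t|)) / 2) • (y + d) + ((1 + t / (1 + |t|)) / 2) • (y - d) := by module
    rw [this]
    have e1 : t / (1 + |t|) ≤ 1 := by rw [div_le_one hpos']; linarith
    have e2 : -1 ≤ t / (1 + |t|) := by rw [le_div_iff₀ hpos']; linarith
    exact hQ h1 h2 (by linarith) (by linarith) (by ring)
  -- A direction at `x = y + t • d` transfers to `y` after scaling: mix `x + w'` with a point on the
  -- other side of `y`, weighted so that the offset `t • d` cancels.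
  have key : ∀ w', x + w' ∈ Q → y + (1 / (2 + |t|)) • w' ∈ Q := by
    intro w' hw'
    have : y + (1 / (2 + |t|)) • w' = (1 / (2 + |t|)) • (x + w') +
        ((1 + |t|) / (2 + |t|)) • (y - (t / (1 + |t|)) • d) := by
      rw [hxt]
      have e1 : (1 + |t|) / (2 + |t|) = 1 - 1 / (2 + |t|) := by field_simp; ring
      have e2 : ((1 + |t|) / (2 + |t|)) * (t / (1 + |t|)) = (1 / (2 + |t|)) * t := by field_simp
      rw [smul_sub, smul_smul, e2, e1]
      module
    rw [this]
    exact hQ hw' hx' (by positivity) (by positivity) (by field_simp; ring)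
  obtain ⟨r, hr⟩ := hd ((1 / (2 + |t|)) • w) (key w hw1) (by
    have := key (-w) (by rwa [← sub_eq_add_neg])
    rwa [smul_neg, ← sub_eq_add_neg] at this)
  have hpq : p - q = (r * (2 + |t|) / (a * b)) • d := by
    have : p - q = ((2 + |t|) / (a * b)) • ((1 / (2 + |t|)) • w) := by
      rw [hw, smul_smul, smul_smul]
      have : (2 + |t|) / (a * b) * (1 / (2 + |t|)) * (a * b) = 1 := by field_simp
      rw [this, one_smul]
    rw [this, hr, smul_smul]
    congr 1; ring
  refine ⟨t + b * (r * (2 + |t|) / (a * b)), ?_⟩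
  have : p = x + b • (p - q) := by
    rw [← hx]; obtain rfl : b = 1 - a := by linarith
    module
  rw [this, hpq, hxt]
  module

/-- The directions at a point of a polyhedron are those annihilated by the active constraints. -/
theorem active_eq_zero {ι : Type*} {a : ι → E →ₗ[ℝ] ℝ} {b : ι → ℝ} {y e : E}
    (h1 : ∀ i, a i (y + e) ≤ b i) (h2 : ∀ i, a i (y - e) ≤ b i) {i : ι} (hi : a i y = b i) :
    a i e = 0 := by
  have h1 := h1 i
  have h2 := h2 i
  rw [map_add] at h1
  rw [map_sub] at h2
  linarith

/-- From a point of a polyhedron one can move a little in each direction that the active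
constraints allow. -/
theorem exists_pos_forall_add_smul_le {ι : Type*} [Finite ι] {a : ι → E →ₗ[ℝ] ℝ} {b : ι → ℝ}
    {w d : E} (hw : ∀ i, a i w ≤ b i) (hd : ∀ i, a i w = b i → a i d ≤ 0) :
    ∃ ε > (0 : ℝ), ∀ t, 0 ≤ t → t ≤ ε → ∀ i, a i (w + t • d) ≤ b i ∧
      (a i (w + t • d) = b i → a i w = b i) := by
  have : ∀ i, ∃ ε > (0 : ℝ), ∀ t, 0 ≤ t → t ≤ ε → a i (w + t • d) ≤ b i ∧
      (a i (w + t • d) = b i → a i w = b i) := by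
    intro i
    simp only [map_add, map_smul, smul_eq_mul]
    rcases (hw i).eq_or_lt with h | h
    · refine ⟨1, one_pos, fun t ht _ => ⟨?_, fun _ => h⟩⟩
      have := mul_nonneg ht (neg_nonneg.2 (hd i h))
      linarith
    · have hden : 0 < 1 + |a i d| := by positivity
      -- Half the slack keeps an inactive constraint inactive; the `1 +` avoids a zero denominator.
      refine ⟨(b i - a i w) / 2 / (1 + |a i d|), by have := sub_pos.2 h; positivity,
        fun t ht hte => ?_⟩
      rw [le_div_iff₀ hden] at hte
      have : t * a i d ≤ t * (1 + |a i d|) :=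
        mul_le_mul_of_nonneg_left (by linarith [le_abs_self (a i d)]) ht
      exact ⟨by linarith, fun h' => by linarith⟩
  choose ε hε h using this
  rcases isEmpty_or_nonempty ι with hι | hι
  · exact ⟨1, one_pos, fun t _ _ i => (hι.false i).elim⟩
  · obtain ⟨j, hj⟩ := Finite.exists_min ε
    exact ⟨ε j, hε j, fun t ht hte i => h i t ht (hte.trans (hj i))⟩

/-- At an extreme point `w` of a polyhedron on which the linear functional `l` is not constant,
there starts an extreme direction `d` along which `l` varies. -/
theorem exists_edge_direction {ι : Type*} [Finite ι] {a : ι → E →ₗ[ℝ] ℝ} {b : ι → ℝ}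
    {w v : E} (hw : w ∈ {q | ∀ i, a i q ≤ b i}.extremePoints ℝ) (hv : ∀ i, a i v ≤ b i)
    (l : E →ₗ[ℝ] ℝ) (hl : l v ≠ l w) :
    ∃ d, (∀ i, a i (w + d) ≤ b i) ∧ (∀ i, a i (w + d + d) ≤ b i) ∧ l d ≠ 0 ∧
      ∀ e, (∀ i, a i (w + d + e) ≤ b i) → (∀ i, a i (w + d - e) ≤ b i) → ∃ t : ℝ, e = t • d := by
  classical
  have := Fintype.ofFinite ι
  have hwQ : ∀ i, a i w ≤ b i := hw.1
  have hpt : ∀ e, (∀ i, a i w = b i → a i e = 0) → e = 0 := by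
    intro e he
    obtain ⟨ε, hε, h⟩ := exists_pos_forall_add_smul_le hwQ (fun i hi => (he i hi).le)
    obtain ⟨δ, hδ, h'⟩ := exists_pos_forall_add_smul_le (d := -e) hwQ
      (fun i hi => by rw [map_neg, he i hi, neg_zero])
    have hm : 0 < min ε δ := lt_min hε hδ
    have := hw.2 (x₁ := w + min ε δ • e) (fun i => (h _ hm.le (min_le_left _ _) i).1)
      (x₂ := w + min ε δ • -e) (fun i => (h' _ hm.le (min_le_right _ _) i).1)
      ⟨1 / 2, 1 / 2, by norm_num, by norm_num, by norm_num, by module⟩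
    rw [add_eq_left, smul_eq_zero] at this
    exact this.resolve_left hm.ne'
  -- Among feasible directions on which `l` does not vanish, choose one annihilated by as many
  -- active constraints as possible.
  let N : E → ℕ := fun d => (Finset.univ.filter fun i => a i w = b i ∧ a i d = 0).card
  let T : Set E := {d | (∀ i, a i w = b i → a i d ≤ 0) ∧ l d ≠ 0}
  have hT : T.Nonempty := ⟨v - w, fun i hi => by rw [map_sub]; linarith [hv i],
    by rw [map_sub]; exact sub_ne_zero.2 hl⟩
  have hbd : BddAbove (N '' T) := by
    refine ⟨Fintype.card ι, ?_⟩
    rintro _ ⟨d, _, rfl⟩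
    exact Finset.card_le_univ _
  obtain ⟨d, hdT, hdN⟩ := Nat.sSup_mem (hT.image N) hbd
  have hmax : ∀ d' ∈ T, N d' ≤ N d := fun d' hd' => by
    rw [hdN]; exact le_csSup hbd ⟨d', hd', rfl⟩
  -- Ratio test: move `d` along `e` until a further active constraint vanishes on it. The value of
  -- `l` is unchanged, so the new direction contradicts maximality.
  have hkey : ∀ e, (∀ i, a i w = b i → a i d = 0 → a i e = 0) → l e = 0 →
      (∃ i, a i w = b i ∧ 0 < a i e) → False := by
    rintro e he hle ⟨i₀, hi₀, hpos₀⟩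
    obtain ⟨j, hj, hjmin⟩ := Finset.exists_min_image
      (Finset.univ.filter fun i => a i w = b i ∧ 0 < a i e) (fun i => -a i d / a i e)
      ⟨i₀, by simp [hi₀, hpos₀]⟩
    simp only [Finset.mem_filter, Finset.mem_univ, true_and] at hj hjmin
    set t := -a j d / a j e with ht
    have ht0 : 0 ≤ t := div_nonneg (neg_nonneg.2 (hdT.1 j hj.1)) hj.2.le
    have hmem : d + t • e ∈ T := by
      refine ⟨fun i hi => ?_, by simpa [hle] using hdT.2⟩
      simp only [map_add, map_smul, smul_eq_mul]
      rcases le_or_gt (a i e) 0 with h | h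
      · have := mul_nonneg ht0 (neg_nonneg.2 h)
        linarith [hdT.1 i hi]
      · have := hjmin i ⟨hi, h⟩
        rw [le_div_iff₀ h] at this
        linarith
    refine (hmax _ hmem).not_gt (Finset.card_lt_card ?_)
    rw [Finset.ssubset_iff_of_subset]
    · refine ⟨j, ?_, ?_⟩
      · have := hj.2.ne'
        simp only [Finset.mem_filter, Finset.mem_univ, true_and, map_add, map_smul, smul_eq_mul]
        refine ⟨hj.1, ?_⟩
        rw [ht]; field_simp; ring
      · simp only [Finset.mem_filter, Finset.mem_univ, true_and, not_and]
        intro _ h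
        exact hj.2.ne' (he j hj.1 h)
    · intro i
      simp only [Finset.mem_filter, Finset.mem_univ, true_and, map_add, map_smul, smul_eq_mul]
      rintro ⟨h, h'⟩
      refine ⟨h, ?_⟩
      rw [h', he i h h']; ring
  have hzero : ∀ e, (∀ i, a i w = b i → a i d = 0 → a i e = 0) → l e = 0 → e = 0 := by
    intro e he hle
    refine hpt e fun i hi => le_antisymm ?_ ?_
    · by_contra! h
      exact hkey e he hle ⟨i, hi, h⟩
    · by_contra! h
      exact hkey (-e) (fun i hi h => by rw [map_neg, he i hi h, neg_zero]) (by simp [hle])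
        ⟨i, hi, by simpa using h⟩
  obtain ⟨ε, hε, h⟩ := exists_pos_forall_add_smul_le hwQ hdT.1
  have hε2 : ε / 2 ≠ 0 := by positivity
  -- Half of the feasible step makes `w + d` the midpoint of a feasible segment. The constraints
  -- active at `w` that vanish on `d` are still active there.
  refine ⟨(ε / 2) • d, fun i => (h _ (by positivity) (by linarith) i).1, fun i => ?_,
    by simpa using ⟨hε.ne', hdT.2⟩, fun e h1 h2 => ?_⟩
  · rw [add_assoc, ← add_smul, add_halves]
    exact (h ε hε.le le_rfl i).1
  · refine ⟨l e / l d / (ε / 2), ?_⟩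
    rw [smul_smul, div_mul_cancel₀ _ hε2, ← sub_eq_zero]
    refine hzero _ (fun i hi hid => ?_) ?_
    · have : a i e = 0 := active_eq_zero h1 h2 (by simp [hi, hid])
      simp [this, hid]
    · have := hdT.2
      simp [this]

/-- A polyhedron has only finitely many extreme points. -/
theorem finite_extremePoints_polyhedron {ι : Type*} [Finite ι] (a : ι → E →ₗ[ℝ] ℝ) (b : ι → ℝ) :
    ({q | ∀ i, a i q ≤ b i}.extremePoints ℝ).Finite := by
  -- An extreme point is determined by its active constraints: if `u` and `v` had the same ones, `v
  -- - u` would be a two-sided direction at `u`, up to scaling.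
  refine Set.Finite.of_finite_image (f := fun q => {i | a i q = b i}) (Set.toFinite _) ?_
  intro u hu v hv huv
  have hiff : ∀ i, a i u = b i ↔ a i v = b i := fun i => Set.ext_iff.1 huv i
  have hz : ∀ i, a i u = b i → a i (v - u) = 0 := fun i hi => by
    rw [map_sub, hi, (hiff i).1 hi, sub_self]
  obtain ⟨ε, hε, h⟩ := exists_pos_forall_add_smul_le hu.1 (fun i hi => (hz i hi).le)
  obtain ⟨δ, hδ, h'⟩ := exists_pos_forall_add_smul_le (d := -(v - u)) hu.1
    (fun i hi => by rw [map_neg, hz i hi, neg_zero])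
  have hm : 0 < min ε δ := lt_min hε hδ
  have := hu.2 (x₁ := u + min ε δ • (v - u)) (fun i => (h _ hm.le (min_le_left _ _) i).1)
    (x₂ := u + min ε δ • -(v - u)) (fun i => (h' _ hm.le (min_le_right _ _) i).1)
    ⟨1 / 2, 1 / 2, by norm_num, by norm_num, by norm_num, by module⟩
  rw [add_eq_left, smul_eq_zero, sub_eq_zero] at this
  exact (this.resolve_left hm.ne').symm

/-- An extreme point of a set that lies on a segment inside the set is an end point of it. -/
theorem eq_or_eq_of_mem_segment {Q : Set E} {u a b : E} (hu : u ∈ Q.extremePoints ℝ)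
    (ha : a ∈ Q) (hb : b ∈ Q) (h : u ∈ segment ℝ a b) : u = a ∨ u = b := by
  rcases (mem_extremePoints_iff_forall_segment.1 hu).2 a ha b hb h with h | h
  · exact Or.inl h.symm
  · exact Or.inr h.symm

/-- Two distinct extreme points on a segment are its end points. -/
theorem segment_eq_of_mem {Q : Set E} {u v a b : E} (hu : u ∈ Q.extremePoints ℝ)
    (hv : v ∈ Q.extremePoints ℝ) (huv : u ≠ v) (ha : a ∈ Q) (hb : b ∈ Q)
    (h : u ∈ segment ℝ a b) (h' : v ∈ segment ℝ a b) : segment ℝ u v = segment ℝ a b := by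
  rcases eq_or_eq_of_mem_segment hu ha hb h with rfl | rfl <;>
    rcases eq_or_eq_of_mem_segment hv ha hb h' with rfl | rfl
  · exact absurd rfl huv
  · rfl
  · exact segment_symm ..
  · exact absurd rfl huv

/-- The intersection of an extreme set with a subset is extreme in the subset. -/
theorem isExtreme_inter_of_subset {Q Q' e : Set E} (he : IsExtreme ℝ Q e) (h : Q' ⊆ Q) :
    IsExtreme ℝ Q' (e ∩ Q') :=
  ⟨Set.inter_subset_right, fun _ hx _ hy _ hz hzxy =>
    ⟨he.2 (h hx) (h hy) hz.1 hzxy, hx⟩⟩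

end Convexity

/-! ### Vertices and edges via proper combinations versus extreme sets -/

section ProperCombinations

variable {m : ℕ}

theorem isProperConvComb_of_mem_openSegment {x y z : Point m} (h : z ∈ openSegment ℝ x y) :
    IsProperConvComb z {x, y} := by
  obtain ⟨a, b, ha, hb, hab, rfl⟩ := h
  refine ⟨2, ![x, y], ![a, b], ?_, by simp [hab], by simp [Set.pair_comm], by simp⟩
  intro i
  fin_cases i
  · exact ⟨ha, by simp; linarith⟩
  · exact ⟨hb, by simp; linarith⟩

theorem IsProperConvComb.nonempty {x : Point m} {U : Set (Point m)} (h : IsProperConvComb x U) :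
    U.Nonempty := by
  obtain ⟨k, y, a, -, hs, rfl, -⟩ := h
  rcases isEmpty_or_nonempty (Fin k) with hk | hk
  · simp at hs
  · exact Set.range_nonempty y

/-- All weights are below 1, so `y` lies in the open segment between any `q i` and the renormalized
combination of the other points. Two-point extremality therefore suffices. -/
theorem subset_of_isProperConvComb {C e W : Set (Point m)} (hC : Convex ℝ C)
    (he : IsExtreme ℝ C e) {y : Point m} (hy : y ∈ e) (hW : W ⊆ C) (h : IsProperConvComb y W) :
    W ⊆ e := by
  obtain ⟨k, q, a, ha, hs, rfl, rfl⟩ := h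
  rintro _ ⟨i, rfl⟩
  have hq : ∀ j, q j ∈ C := fun j => hW ⟨j, rfl⟩
  have hsum : a i + ∑ j ∈ Finset.univ.erase i, a j = 1 := by
    rw [Finset.add_sum_erase _ _ (Finset.mem_univ i), hs]
  have hi := ha i
  have hpos : 0 < 1 - a i := by linarith [hi.2]
  refine he.2 (y := ∑ j ∈ Finset.univ.erase i, (a j / (1 - a i)) • q j) (hq i) ?_ hy ?_
  · refine hC.sum_mem (fun j _ => div_nonneg (ha j).1.le hpos.le) ?_ (fun j _ => hq j)
    rw [← Finset.sum_div, div_eq_one_iff_eq hpos.ne']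
    linarith
  · refine ⟨a i, 1 - a i, hi.1, hpos, by ring, ?_⟩
    rw [Finset.smul_sum, ← Finset.add_sum_erase _ _ (Finset.mem_univ i)]
    congr 1
    refine Finset.sum_congr rfl fun j _ => ?_
    rw [smul_smul, mul_div_cancel₀ _ hpos.ne']

theorem vertices_eq_extremePoints {C : Set (Point m)} (hC : Convex ℝ C) :
    vertices C = C.extremePoints ℝ := by
  ext v
  constructor
  · rintro ⟨hv, h⟩
    refine ⟨hv, fun x hx y hy hxy => ?_⟩
    have := h {x, y} (Set.insert_subset hx (Set.singleton_subset_iff.2 hy))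
      (isProperConvComb_of_mem_openSegment hxy)
    have hx' : x ∈ ({x, y} : Set (Point m)) := Set.mem_insert _ _
    rw [this] at hx'
    exact hx'
  · intro hv
    refine ⟨hv.1, fun U hU h => ?_⟩
    exact h.nonempty.subset_singleton_iff.1
      (subset_of_isProperConvComb hC (isExtreme_singleton.2 hv) rfl hU h)

theorem mem_segmentEdges {C : Set (Point m)} (hC : Convex ℝ C) {e : Set (Point m)} :
    e ∈ segmentEdges C ↔ ∃ u ∈ C.extremePoints ℝ, ∃ v ∈ C.extremePoints ℝ, u ≠ v ∧
      e = segment ℝ u v ∧ IsExtreme ℝ C e := by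
  rw [segmentEdges, vertices_eq_extremePoints hC]
  refine exists_congr fun u => and_congr_right fun hu => exists_congr fun v =>
    and_congr_right fun hv => and_congr_right fun huv => and_congr_right fun he => ?_
  constructor
  · intro h
    refine ⟨he ▸ hC.segment_subset hu.1 hv.1, fun x hx y hy z hz hzxy => ?_⟩
    exact h z hz {x, y} (Set.insert_subset hx (Set.singleton_subset_iff.2 hy))
      (isProperConvComb_of_mem_openSegment hzxy) (Set.mem_insert _ _)
  · intro h y hy W hW hyW
    exact subset_of_isProperConvComb hC h hy hW hyW

end ProperCombinations

/-! ### The polyhedron under an induced dual over the box -/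

section Hypograph

variable {n m : ℕ} {p : Problem n m} {M : ℝ} {X : Set (Fin n → Bool)}

/-- The linear functional whose level set at height `f x` is the hyperplane `P_x`. -/
def height (p : Problem n m) (x : Fin n → Bool) : Point m →ₗ[ℝ] ℝ where
  toFun q := q.2 - ∑ i, q.1 i * (p.h i x - p.b i)
  map_add' q r := by
    simp only [Prod.snd_add, Prod.fst_add, Pi.add_apply, add_mul, Finset.sum_add_distrib]; ring
  map_smul' c q := by
    simp only [Prod.smul_snd, Prod.smul_fst, Pi.smul_apply, smul_eq_mul, RingHom.id_apply,
      mul_sub, Finset.mul_sum, mul_assoc]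

theorem height_le_iff {x : Fin n → Bool} {q : Point m} :
    height p x q ≤ p.f x ↔ q.2 ≤ lagrangian p x q.1 := by
  simp only [height, lagrangian, LinearMap.coe_mk, AddHom.coe_mk, sub_le_iff_le_add]

theorem lt_height_iff {x : Fin n → Bool} {q : Point m} :
    p.f x < height p x q ↔ lagrangian p x q.1 < q.2 := by
  rw [← not_le, height_le_iff, not_le]

theorem height_eq_iff {x : Fin n → Bool} {q : Point m} :
    height p x q = p.f x ↔ q.2 = lagrangian p x q.1 := by
  simp only [height, lagrangian, LinearMap.coe_mk, AddHom.coe_mk, sub_eq_iff_eq_add]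

theorem continuous_lagrangian (p : Problem n m) (x : Fin n → Bool) :
    Continuous (lagrangian p x) := by
  unfold lagrangian
  fun_prop

/-- The hypograph over the box of the induced dual `g_X`. -/
def region (p : Problem n m) (M : ℝ) (X : Set (Fin n → Bool)) : Set (Point m) :=
  hypograph M (inducedDual p X)

theorem mem_region_iff_le {q : Point m} :
    q ∈ region p M X ↔ q.1 ∈ box m M ∧ q.2 ≤ inducedDual p X q.1 := Iff.rfl

theorem le_inducedDual_iff (hX : X.Nonempty) {l : Fin m → ℝ} {z : ℝ} :
    z ≤ inducedDual p X l ↔ ∀ x ∈ X, z ≤ lagrangian p x l := by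
  have h := inducedDual_isLeast p hX l
  constructor
  · exact fun hz x hx => hz.trans (h.2 ⟨x, hx, rfl⟩)
  · intro hz
    obtain ⟨x, hx, he⟩ := h.1
    exact (hz x hx).trans_eq he

theorem mem_region (hX : X.Nonempty) {q : Point m} :
    q ∈ region p M X ↔ q.1 ∈ box m M ∧ ∀ x ∈ X, q.2 ≤ lagrangian p x q.1 := by
  rw [mem_region_iff_le, le_inducedDual_iff hX]

theorem inducedDual_insert (hX : X.Nonempty) (x : Fin n → Bool) (l : Fin m → ℝ) :
    inducedDual p (insert x X) l = min (inducedDual p X l) (lagrangian p x l) := by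
  refine eq_of_forall_le_iff fun z => ?_
  rw [le_min_iff, le_inducedDual_iff hX, le_inducedDual_iff (Set.insert_nonempty _ _),
    Set.forall_mem_insert, and_comm]

theorem mem_region_insert (hX : X.Nonempty) {x : Fin n → Bool} {q : Point m} :
    q ∈ region p M (insert x X) ↔ q ∈ region p M X ∧ q.2 ≤ lagrangian p x q.1 := by
  rw [mem_region_iff_le, mem_region_iff_le, inducedDual_insert hX, le_min_iff, and_assoc]

theorem region_insert_subset (hX : X.Nonempty) {x : Fin n → Bool} :
    region p M (insert x X) ⊆ region p M X := fun _ h => ((mem_region_insert hX).1 h).1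

/-- One constraint per element of `X` and two per box coordinate; this form makes the polyhedral
lemmas applicable. -/
theorem exists_region_eq_polyhedron (p : Problem n m) (M : ℝ) (hX : X.Nonempty) :
    ∃ (a : X ⊕ Fin m ⊕ Fin m → Point m →ₗ[ℝ] ℝ) (b : X ⊕ Fin m ⊕ Fin m → ℝ),
      region p M X = {q | ∀ i, a i q ≤ b i} := by
  refine ⟨Sum.elim (fun x => height p x.1) (Sum.elim
    (fun i => LinearMap.proj i ∘ₗ LinearMap.fst ℝ _ _)
    (fun i => -(LinearMap.proj i ∘ₗ LinearMap.fst ℝ _ _))),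
    Sum.elim (fun x => p.f x.1) (fun _ => M), ?_⟩
  ext q
  rw [mem_region hX]
  simp only [Set.mem_ofPred_eq, Sum.forall, Sum.elim_inl, Sum.elim_inr, height_le_iff,
    Subtype.forall, box, Set.mem_Icc, LinearMap.neg_apply, LinearMap.comp_apply,
    LinearMap.fst_apply, LinearMap.proj_apply, forall_and, neg_le]
  tauto

theorem convex_region (hX : X.Nonempty) : Convex ℝ (region p M X) := by
  obtain ⟨a, b, h⟩ := exists_region_eq_polyhedron p M hX
  rw [h, Set.ofPred_forall]
  exact convex_iInter fun i => convex_halfSpace_le (a i).isLinear (b i)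

theorem isClosed_region (hX : X.Nonempty) : IsClosed (region p M X) := by
  obtain ⟨a, b, h⟩ := exists_region_eq_polyhedron p M hX
  rw [h, Set.ofPred_forall]
  exact isClosed_iInter fun i =>
    isClosed_le (a i).continuous_of_finiteDimensional continuous_const

theorem finite_extremePoints_region (hX : X.Nonempty) :
    ((region p M X).extremePoints ℝ).Finite := by
  obtain ⟨a, b, h⟩ := exists_region_eq_polyhedron p M hX
  rw [h]
  exact finite_extremePoints_polyhedron a b

theorem mem_region_of_le {l : Fin m → ℝ} {z z' : ℝ} (h : (l, z) ∈ region p M X) (hz : z' ≤ z) :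
    (l, z') ∈ region p M X := ⟨h.1, hz.trans h.2⟩

theorem isCompact_box (m : ℕ) (M : ℝ) : IsCompact (box m M) := by
  have : box m M = Set.univ.pi fun _ => Set.Icc (-M) M := by
    ext l
    simp [box, Pi.le_def, forall_and]
  rw [this]
  exact isCompact_univ_pi fun _ => isCompact_Icc

theorem corners_subset_box (hM : 0 < M) : corners m M ⊆ box m M := by
  intro l hl i
  rcases hl i with h | h <;> rw [h] <;> constructor <;> linarith

theorem eq_of_mem_corners {l x y : Fin m → ℝ} (hl : l ∈ corners m M) (hx : x ∈ box m M)
    (hy : y ∈ box m M) (h : l ∈ openSegment ℝ x y) : x = l := by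
  obtain ⟨a, b, ha, hb, hab, rfl⟩ := h
  funext i
  have hx := hx i
  have hy := hy i
  simp only [Set.mem_Icc] at hx hy
  have hi := hl i
  simp only [Pi.add_apply, Pi.smul_apply, smul_eq_mul] at hi ⊢
  obtain rfl : b = 1 - a := by linarith
  rcases hi with hi | hi
  · have h1 := mul_nonneg ha.le (sub_nonneg.2 hx.1)
    have h2 := mul_nonneg hb.le (sub_nonneg.2 hy.1)
    have h3 : a * (x i - -M) = 0 := by nlinarith
    have := (mul_eq_zero.1 h3).resolve_left ha.ne'
    linarith
  · have h1 := mul_nonneg ha.le (sub_nonneg.2 hx.2)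
    have h2 := mul_nonneg hb.le (sub_nonneg.2 hy.2)
    have h3 : a * (M - x i) = 0 := by nlinarith
    have := (mul_eq_zero.1 h3).resolve_left ha.ne'
    linarith

theorem exists_perturbation {l : Fin m → ℝ} (hl : l ∈ box m M) (hc : l ∉ corners m M) :
    ∃ d ≠ 0, l + d ∈ box m M ∧ l - d ∈ box m M := by
  classical
  simp only [corners, Set.mem_ofPred_eq, not_forall, not_or] at hc
  obtain ⟨i, h1, h2⟩ := hc
  have hi := hl i
  have h1 : -M < l i := lt_of_le_of_ne hi.1 (Ne.symm h1)
  have h2 : l i < M := lt_of_le_of_ne hi.2 h2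
  have hpos : 0 < min (M - l i) (l i + M) := lt_min (by linarith) (by linarith)
  have hm1 := min_le_left (M - l i) (l i + M)
  have hm2 := min_le_right (M - l i) (l i + M)
  refine ⟨Pi.single i (min (M - l i) (l i + M)), by simpa using hpos.ne', fun j => ?_,
    fun j => ?_⟩ <;> rcases eq_or_ne j i with rfl | hj
  · simp only [Pi.add_apply, Pi.single_eq_same]; constructor <;> linarith
  · simpa [hj] using hl j
  · simp only [Pi.sub_apply, Pi.single_eq_same]; constructor <;> linarith
  · simpa [hj] using hl j

theorem snd_eq_of_mem_extremePoints {u : Point m} (hu : u ∈ (region p M X).extremePoints ℝ) :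
    u.2 = inducedDual p X u.1 := by
  refine le_antisymm hu.1.2 (not_lt.1 fun h => ?_)
  have := hu.2 (x₁ := (u.1, inducedDual p X u.1)) ⟨hu.1.1, le_rfl⟩
    -- The reflection in `u` of the point vertically above it on the graph.
    (x₂ := (u.1, 2 * u.2 - inducedDual p X u.1)) ⟨hu.1.1, by simp only; linarith⟩
    ⟨1 / 2, 1 / 2, by norm_num, by norm_num, by norm_num, by
      ext
      · simp; ring
      · simp; ring⟩
  have := congrArg Prod.snd this
  simp only at this
  linarith

theorem fst_mem_openSegment {x y z : Point m} (h : z ∈ openSegment ℝ x y) :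
    z.1 ∈ openSegment ℝ x.1 y.1 := by
  obtain ⟨a, b, ha, hb, hab, rfl⟩ := h
  exact ⟨a, b, ha, hb, hab, rfl⟩

/-- A corner is extreme in the box, so the whole fibre of the region over it is extreme. -/
theorem isExtreme_downRay {l : Fin m → ℝ} (hM : 0 < M) (hl : l ∈ corners m M) :
    IsExtreme ℝ (region p M X) (downRay (l, inducedDual p X l)) := by
  constructor
  · rintro ⟨l', z⟩ ⟨h1, h2⟩
    obtain rfl : l' = l := h1
    exact ⟨corners_subset_box hM hl, h2⟩
  · intro x hx y hy z hz hzxy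
    have := fst_mem_openSegment hzxy
    rw [hz.1] at this
    have hxl := eq_of_mem_corners hl hx.1 hy.1 this
    refine ⟨hxl, ?_⟩
    have := hx.2
    rwa [hxl] at this

theorem corner_mem_extremePoints {l : Fin m → ℝ} (hM : 0 < M) (hl : l ∈ corners m M) :
    (l, inducedDual p X l) ∈ (region p M X).extremePoints ℝ := by
  refine (isExtreme_downRay hM hl).extremePoints_subset_extremePoints ⟨⟨rfl, le_rfl⟩, ?_⟩
  rintro ⟨x, s⟩ hx ⟨y, t⟩ hy ⟨a, b, ha, hb, hab, h⟩
  obtain rfl : x = l := hx.1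
  have hs : s ≤ inducedDual p X x := hx.2
  have ht : t ≤ inducedDual p X x := hy.2
  have h2 := congrArg Prod.snd h
  simp only [Prod.snd_add, Prod.smul_snd, smul_eq_mul] at h2
  obtain rfl : b = 1 - a := by linarith
  have h3 : a * (inducedDual p X x - s) = 0 := by
    nlinarith [mul_nonneg ha.le (sub_nonneg.2 hs), mul_nonneg hb.le (sub_nonneg.2 ht)]
  have := (mul_eq_zero.1 h3).resolve_left ha.ne'
  ext1
  · rfl
  · simp only; linarith

theorem skeletonVertices_eq (hX : X.Nonempty) :
    skeletonVertices M (inducedDual p X) = (region p M X).extremePoints ℝ :=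
  vertices_eq_extremePoints (convex_region hX)

/-! ### Edges of the region and their geometry -/

/-- The edges of the skeleton of `g_X`. -/
def regionEdges (p : Problem n m) (M : ℝ) (X : Set (Fin n → Bool)) : Set (Set (Point m)) :=
  skeletonEdges M (inducedDual p X)

theorem mem_regionEdges (hM : 0 < M) (hX : X.Nonempty) {e : Set (Point m)} :
    e ∈ regionEdges p M X ↔
      (∃ u ∈ (region p M X).extremePoints ℝ, ∃ v ∈ (region p M X).extremePoints ℝ, u ≠ v ∧
        e = segment ℝ u v ∧ IsExtreme ℝ (region p M X) e) ∨
      ∃ l ∈ corners m M, e = downRay (l, inducedDual p X l) := by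
  rw [regionEdges, skeletonEdges, Set.mem_union]
  refine or_congr (mem_segmentEdges (convex_region hX)) ?_
  rw [skeletonVertices_eq hX]
  constructor
  · rintro ⟨u, hu, hc, rfl⟩
    exact ⟨u.1, hc, by rw [← snd_eq_of_mem_extremePoints hu]⟩
  · rintro ⟨l, hl, rfl⟩
    exact ⟨_, corner_mem_extremePoints hM hl, hl, rfl⟩

theorem isExtreme_of_mem_regionEdges (hM : 0 < M) (hX : X.Nonempty) {e : Set (Point m)}
    (he : e ∈ regionEdges p M X) : IsExtreme ℝ (region p M X) e := by
  rcases (mem_regionEdges hM hX).1 he with ⟨_, _, _, _, _, _, h⟩ | ⟨l, hl, rfl⟩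
  · exact h
  · exact isExtreme_downRay hM hl

theorem left_mem_extremePoints_segment {E : Type*} [AddCommGroup E] [Module ℝ E] (a b : E) :
    a ∈ (segment ℝ a b).extremePoints ℝ := by
  refine ⟨left_mem_segment _ _ _, ?_⟩
  rintro x hx y hy ⟨α, β, hα, hβ, hαβ, h⟩
  rw [segment_eq_image'] at hx hy
  obtain ⟨s, hs, rfl⟩ := hx
  obtain ⟨t, ht, rfl⟩ := hy
  have h' : (α * s + β * t) • (b - a) = 0 := by
    have : α • (a + s • (b - a)) + β • (a + t • (b - a)) =
        (α + β) • a + (α * s + β * t) • (b - a) := by module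
    rw [this, hαβ, one_smul, add_eq_left] at h
    exact h
  rcases smul_eq_zero.1 h' with h' | h'
  · have h1 := mul_nonneg hα.le hs.1
    have h2 := mul_nonneg hβ.le ht.1
    have h3 : α * s = 0 := by linarith
    rw [(mul_eq_zero.1 h3).resolve_left hα.ne']
    simp
  · simp [h']

/-- A point of the region at which the two-sided directions span a line lies on an edge. -/
theorem exists_edge_of_line (hM : 0 < M) (hX : X.Nonempty) {y d : Point m} (hd0 : d ≠ 0)
    (h1 : y + d ∈ region p M X) (h2 : y - d ∈ region p M X)
    (hd : ∀ e, y + e ∈ region p M X → y - e ∈ region p M X → ∃ t : ℝ, e = t • d) :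
    ∃ e ∈ regionEdges p M X, y ∈ e := by
  have hconv := convex_region (p := p) (M := M) hX
  have hext := isExtreme_inter_line hconv h1 h2 hd
  have hy : y ∈ region p M X := by
    have : y = (1 / 2 : ℝ) • (y + d) + (1 / 2 : ℝ) • (y - d) := by module
    rw [this]
    exact hconv h1 h2 (by norm_num) (by norm_num) (by norm_num)
  -- For vertical `d` the edge is a ray and `y.1` must be a corner; otherwise the boundedness of the
  -- box makes the extreme line piece a segment.
  by_cases hd1 : d.1 = 0
  · have hd2 : d.2 ≠ 0 := fun h => hd0 (Prod.ext hd1 h)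
    refine ⟨downRay (y.1, inducedDual p X y.1),
      (mem_regionEdges hM hX).2 (Or.inr ⟨y.1, ?_, rfl⟩), rfl, hy.2⟩
    by_contra hc
    obtain ⟨c, hc0, hc1, hc2⟩ := exists_perturbation hy.1 hc
    -- At this height `(y.1, s)` is the midpoint of two points of the region off the vertical line,
    -- contradicting extremality of the line piece.
    set s := min y.2 (min (inducedDual p X (y.1 + c)) (inducedDual p X (y.1 - c)))
    have hs1 : s ≤ inducedDual p X (y.1 + c) := (min_le_right _ _).trans (min_le_left _ _)
    have hs2 : s ≤ inducedDual p X (y.1 - c) := (min_le_right _ _).trans (min_le_right _ _)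
    have hmem : (y.1 + c, s) ∈ region p M X ∩ {q | ∃ t : ℝ, q = y + t • d} := by
      refine hext.2 (x := (y.1 + c, s)) ⟨hc1, hs1⟩ (y := (y.1 - c, s)) ⟨hc2, hs2⟩
        (z := (y.1, s)) ⟨mem_region_of_le hy (min_le_left _ _), (s - y.2) / d.2, ?_⟩
        ⟨1 / 2, 1 / 2, by norm_num, by norm_num, by norm_num, ?_⟩
      · ext1
        · simp [hd1]
        · simp only [Prod.snd_add, Prod.smul_snd, smul_eq_mul]
          field_simp
          ring
      · ext1
        · simp only [Prod.fst_add, Prod.smul_fst]; module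
        · simp only [Prod.snd_add, Prod.smul_snd]; module
    obtain ⟨-, t, ht⟩ := hmem
    have := congrArg Prod.fst ht
    simp only [Prod.fst_add, Prod.smul_fst, hd1, smul_zero, add_zero, add_eq_left] at this
    exact hc0 this
  · obtain ⟨i, hi⟩ := Function.ne_iff.1 hd1
    have hi : d.1 i ≠ 0 := hi
    let T : Set ℝ := {t | y + t • d ∈ region p M X}
    have hTc : IsClosed T := (isClosed_region hX).preimage (by fun_prop)
    have hTb : T ⊆ Set.Icc (-((M + |y.1 i|) / |d.1 i|)) ((M + |y.1 i|) / |d.1 i|) := by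
      intro t ht
      rw [Set.mem_Icc, ← abs_le, le_div_iff₀ (abs_pos.2 hi), ← abs_mul]
      have := ht.1 i
      simp only [Prod.fst_add, Prod.smul_fst, Pi.add_apply, Pi.smul_apply, smul_eq_mul,
        Set.mem_Icc] at this
      rw [abs_le]
      constructor <;> linarith [neg_abs_le (y.1 i), le_abs_self (y.1 i)]
    have hT : IsCompact T := isCompact_Icc.of_isClosed_subset hTc hTb
    have h1T : (1 : ℝ) ∈ T := by simpa [T] using h1
    have h2T : (-1 : ℝ) ∈ T := by simpa [T, ← sub_eq_add_neg] using h2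
    obtain ⟨t₁, ht₁, hmin⟩ := hT.exists_isLeast ⟨1, h1T⟩
    obtain ⟨t₂, ht₂, hmax⟩ := hT.exists_isGreatest ⟨1, h1T⟩
    have ha := hmin h2T
    have hb := hmax h1T
    have hlt : 0 < t₂ - t₁ := by linarith
    have hseg : region p M X ∩ {q | ∃ t : ℝ, q = y + t • d} =
        segment ℝ (y + t₁ • d) (y + t₂ • d) := by
      apply Set.Subset.antisymm
      · rintro _ ⟨hq, t, rfl⟩
        have e1 := hmin hq
        have e2 := hmax hq
        refine ⟨(t₂ - t) / (t₂ - t₁), (t - t₁) / (t₂ - t₁), div_nonneg (by linarith) hlt.le,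
          div_nonneg (by linarith) hlt.le, by field_simp; ring, ?_⟩
        have e3 : (t₂ - t) / (t₂ - t₁) = 1 - (t - t₁) / (t₂ - t₁) := by field_simp; ring
        have e4 : t = t₁ + (t - t₁) / (t₂ - t₁) * (t₂ - t₁) := by field_simp; ring
        rw [e3]
        conv_rhs => rw [e4]
        module
      · intro q hq
        refine ⟨hconv.segment_subset ht₁ ht₂ hq, ?_⟩
        obtain ⟨a, b, -, -, hab, rfl⟩ := hq
        refine ⟨a * t₁ + b * t₂, ?_⟩
        obtain rfl : b = 1 - a := by linarith
        module
    rw [hseg] at hext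
    refine ⟨_, (mem_regionEdges hM hX).2 (Or.inl ⟨_, ?_, _, ?_, ?_, rfl, hext⟩), ?_⟩
    · exact hext.extremePoints_subset_extremePoints (left_mem_extremePoints_segment _ _)
    · refine hext.extremePoints_subset_extremePoints ?_
      rw [segment_symm]
      exact left_mem_extremePoints_segment _ _
    · intro h
      rw [add_right_inj, ← sub_eq_zero, ← sub_smul, smul_eq_zero] at h
      rcases h with h | h
      · linarith
      · exact hd0 h
    · rw [← hseg]
      exact ⟨hy, 0, by simp⟩

/-- A vertex on a hyperplane that does not bound the region starts an edge leaving the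
hyperplane. -/
theorem exists_edge_not_subset (hM : 0 < M) (hX : X.Nonempty) {x : Fin n → Bool} {w v : Point m}
    (hw : w ∈ (region p M X).extremePoints ℝ) (hwx : w ∈ hyperplane p x)
    (hv : v ∈ region p M X) (hvx : lagrangian p x v.1 < v.2) :
    ∃ e ∈ regionEdges p M X, ¬ e ⊆ hyperplane p x ∧ w ∈ e := by
  obtain ⟨a, b, h⟩ := exists_region_eq_polyhedron p M hX
  have hwx := height_eq_iff.2 hwx
  have hvx := lt_height_iff.2 hvx
  have hmem : ∀ q, q ∈ region p M X ↔ ∀ i, a i q ≤ b i := fun q => by rw [h]; rfl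
  rw [h] at hw
  obtain ⟨d, h1, h2, hl, hd⟩ := exists_edge_direction hw ((hmem v).1 hv) (height p x)
    (by rw [hwx]; exact hvx.ne')
  simp only [← hmem] at h1 h2 hd
  obtain ⟨e, he, hye⟩ := exists_edge_of_line hM hX (y := w + d) (d := d)
    (by rintro rfl; simp at hl) h2 (by simpa using (hmem w).2 hw.1) hd
  refine ⟨e, he, fun hsub => ?_, ?_⟩
  · have := height_eq_iff.2 (hsub hye)
    rw [map_add, hwx, add_eq_left] at this
    exact hl this
  · exact (isExtreme_of_mem_regionEdges hM hX he).2 ((hmem w).2 hw.1) h2 hye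
      ⟨1 / 2, 1 / 2, by norm_num, by norm_num, by norm_num, by module⟩

theorem downRay_injective : Function.Injective (downRay (m := m)) := by
  intro u v h
  have h1 : u ∈ downRay v := by rw [← h]; exact ⟨rfl, le_rfl⟩
  have h2 : v ∈ downRay u := by rw [h]; exact ⟨rfl, le_rfl⟩
  exact Prod.ext h1.1 (le_antisymm h1.2 h2.2)

/-- Edges are bare sets, so rays and segments are told apart by shape: the ray has points lower than
both `a` and `b`. -/
theorem downRay_ne_segment (u a b : Point m) : downRay u ≠ segment ℝ a b := by
  intro h
  have hmem : (u.1, min u.2 (min a.2 b.2 - 1)) ∈ segment ℝ a b := by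
    rw [← h]; exact ⟨rfl, min_le_left _ _⟩
  obtain ⟨s, t, hs, ht, hst, h⟩ := hmem
  have h := congrArg Prod.snd h
  simp only [Prod.snd_add, Prod.smul_snd, smul_eq_mul] at h
  have h1 : min u.2 (min a.2 b.2 - 1) ≤ min a.2 b.2 - 1 := min_le_right _ _
  have h2 := mul_le_mul_of_nonneg_left (min_le_left a.2 b.2) hs
  have h3 := mul_le_mul_of_nonneg_left (min_le_right a.2 b.2) ht
  obtain rfl : t = 1 - s := by linarith
  linarith

/-- The updates refer to an edge through arbitrary end points `a`, `b`; these must be the vertices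
of the edge, up to order. -/
theorem segment_mem_regionEdges (hM : 0 < M) (hX : X.Nonempty) {a b : Point m}
    (h : segment ℝ a b ∈ regionEdges p M X) :
    a ∈ (region p M X).extremePoints ℝ ∧ b ∈ (region p M X).extremePoints ℝ ∧ a ≠ b := by
  rcases (mem_regionEdges hM hX).1 h with ⟨u, hu, v, hv, huv, he, hext⟩ | ⟨l, -, hl⟩
  · have ha : a ∈ region p M X := hext.1 (left_mem_segment _ _ _)
    have hb : b ∈ region p M X := hext.1 (right_mem_segment _ _ _)
    have hu' : u ∈ segment ℝ a b := by rw [he]; exact left_mem_segment _ _ _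
    have hv' : v ∈ segment ℝ a b := by rw [he]; exact right_mem_segment _ _ _
    rcases eq_or_eq_of_mem_segment hu ha hb hu' with rfl | rfl <;>
      rcases eq_or_eq_of_mem_segment hv ha hb hv' with rfl | rfl
    · exact absurd rfl huv
    · exact ⟨hu, hv, huv⟩
    · exact ⟨hv, hu, huv.symm⟩
    · exact absurd rfl huv
  · exact absurd hl.symm (downRay_ne_segment _ _ _)

theorem downRay_mem_regionEdges (hM : 0 < M) (hX : X.Nonempty) {u : Point m}
    (h : downRay u ∈ regionEdges p M X) :
    u.1 ∈ corners m M ∧ u.2 = inducedDual p X u.1 := by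
  rcases (mem_regionEdges hM hX).1 h with ⟨a, _, b, _, _, he, _⟩ | ⟨l, hl, he⟩
  · exact absurd he (downRay_ne_segment _ _ _)
  · rw [downRay_injective he]
    exact ⟨hl, rfl⟩

end Hypograph

/-! ### Vertices and facet after a cut by a hyperplane -/

section Cutting

variable {n m : ℕ} {p : Problem n m} {M : ℝ} {X : Set (Fin n → Bool)} {x : Fin n → Bool}

/-- An edge that meets a hyperplane in two points lies in it. -/
theorem edge_subset_hyperplane (hM : 0 < M) (hX : X.Nonempty) {e : Set (Point m)}
    (he : e ∈ regionEdges p M X) {q r : Point m} (hq : q ∈ e) (hr : r ∈ e) (hqr : q ≠ r)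
    (hqx : q ∈ hyperplane p x) (hrx : r ∈ hyperplane p x) : e ⊆ hyperplane p x := by
  rcases (mem_regionEdges hM hX).1 he with ⟨a, _, b, _, _, rfl, _⟩ | ⟨l, _, rfl⟩
  · rw [segment_eq_image'] at hq hr ⊢
    obtain ⟨s, -, rfl⟩ := hq
    obtain ⟨t, -, rfl⟩ := hr
    have h1 := height_eq_iff.2 hqx
    have h2 := height_eq_iff.2 hrx
    simp only [map_add, map_smul, smul_eq_mul] at h1 h2
    have hst : s - t ≠ 0 := fun h => hqr (by rw [sub_eq_zero.1 h])
    have h3 : (s - t) * height p x (b - a) = 0 := by linarith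
    have h4 := (mul_eq_zero.1 h3).resolve_left hst
    rintro _ ⟨c, -, rfl⟩
    refine height_eq_iff.1 ?_
    simp only [map_add, map_smul, smul_eq_mul, h4, mul_zero, add_zero] at h1 ⊢
    exact h1
  · refine absurd (Prod.ext (hq.1.trans hr.1.symm) ?_) hqr
    rw [show q.2 = _ from hqx, show r.2 = _ from hrx, hq.1, hr.1]

/-- If `u` is inside a segment of the cut region, extremality of the old edge puts both ends on that
edge. Neither end is above `P_x` and `u` is on it, so both are on `P_x`; a crossing edge meets `P_x`
only once. -/
theorem mem_extremePoints_of_mem_newVertices (hM : 0 < M) (hX : X.Nonempty) {u : Point m}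
    (hu : u ∈ newVertices p x (regionEdges p M X)) :
    u ∈ (region p M (insert x X)).extremePoints ℝ := by
  obtain ⟨e, he, hne, hux, hue⟩ := hu
  have hext := isExtreme_of_mem_regionEdges hM hX he
  refine ⟨(mem_region_insert hX).2 ⟨hext.1 hue, hux.le⟩, fun q hq r hr h => ?_⟩
  have hq' := (mem_region_insert hX).1 hq
  have hr' := (mem_region_insert hX).1 hr
  have hqe := hext.2 hq'.1 hr'.1 hue h
  have hre := hext.right_mem_of_mem_openSegment hq'.1 hr'.1 hue h
  obtain ⟨a, b, ha, hb, hab, rfl⟩ := h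
  have h1 := height_le_iff.2 hq'.2
  have h2 := height_le_iff.2 hr'.2
  have h3 := height_eq_iff.2 hux
  simp only [map_add, map_smul, smul_eq_mul] at h3
  obtain rfl : b = 1 - a := by linarith
  have h4 := mul_nonneg ha.le (sub_nonneg.2 h1)
  have h5 := mul_nonneg hb.le (sub_nonneg.2 h2)
  have h6 : a * (p.f x - height p x q) = 0 := by linarith
  have h7 : (1 - a) * (p.f x - height p x r) = 0 := by linarith
  have h6 := (mul_eq_zero.1 h6).resolve_left ha.ne'
  have h7 := (mul_eq_zero.1 h7).resolve_left hb.ne'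
  by_contra hne'
  refine hne (edge_subset_hyperplane hM hX he hqe hre ?_
    (height_eq_iff.1 (by linarith)) (height_eq_iff.1 (by linarith)))
  rintro rfl
  exact hne' (by module)

/-- Points strictly below the hyperplane can move a little within the cut region. -/
theorem exists_pos_forall_mem_region_insert (hX : X.Nonempty) {u q : Point m}
    (hu : u ∈ region p M X) (hux : u.2 < lagrangian p x u.1) (hq : q ∈ region p M X) :
    ∃ ε > (0 : ℝ), ε ≤ 1 ∧ ∀ t, 0 ≤ t → t ≤ ε → u + t • (q - u) ∈ region p M (insert x X) := by
  have hux : height p x u < p.f x :=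
    lt_of_le_of_ne (height_le_iff.2 hux.le) fun h => hux.ne (height_eq_iff.1 h)
  obtain ⟨ε, hε, h⟩ := exists_pos_forall_add_smul_le (ι := Unit) (a := fun _ => height p x)
    (b := fun _ => p.f x) (w := u) (d := q - u) (fun _ => hux.le) (fun _ h => absurd h hux.ne)
  refine ⟨min ε 1, lt_min hε one_pos, min_le_right _ _, fun t ht hte => ?_⟩
  refine (mem_region_insert hX).2 ⟨?_, height_le_iff.1 (h t ht (hte.trans (min_le_left _ _)) ()).1⟩
  have : u + t • (q - u) = (1 - t) • u + t • q := by module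
  rw [this]
  exact convex_region hX hu hq (sub_nonneg.2 (hte.trans (min_le_right _ _))) ht (by ring)

theorem exists_direction_of_not_mem_extremePoints {E : Type*} [AddCommGroup E] [Module ℝ E]
    {Q : Set E} (hQ : Convex ℝ Q) {u : E} (hu : u ∈ Q) (h : u ∉ Q.extremePoints ℝ) :
    ∃ d ≠ 0, u + d ∈ Q ∧ u - d ∈ Q := by
  simp only [Set.extremePoints, Set.mem_ofPred_eq, not_and, not_forall] at h
  obtain ⟨q, hq, r, hr, ⟨a, b, ha, hb, hab, rfl⟩, hne⟩ := h hu
  obtain rfl : b = 1 - a := by linarith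
  refine ⟨(a * (1 - a)) • (q - r), ?_, ?_, ?_⟩
  · refine smul_ne_zero (mul_pos ha hb).ne' (sub_ne_zero.2 ?_)
    rintro rfl
    exact hne (by module)
  · have : a • q + (1 - a) • r + (a * (1 - a)) • (q - r) =
        (a + a * (1 - a)) • q + ((1 - a) * (1 - a)) • r := by module
    rw [this]
    exact hQ hq hr (by positivity) (by positivity) (by ring)
  · have : a • q + (1 - a) • r - (a * (1 - a)) • (q - r) =
        (a * a) • q + ((1 - a) + a * (1 - a)) • r := by module
    rw [this]
    exact hQ hq hr (by positivity) (by positivity) (by ring)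

/-- For `r` the ratio of the heights of `e` and `d`, the vector `e - r • d` is parallel to `P_x`;
this is how directions at a point of `P_x` are reduced modulo `d`. -/
theorem add_smul_sub_smul_mem {E : Type*} [AddCommGroup E] [Module ℝ E] {Q : Set E}
    (hQ : Convex ℝ Q) {u d e : E} (h1 : u + d ∈ Q) (h2 : u - d ∈ Q) (he : u + e ∈ Q) (r : ℝ) :
    u + (1 / (1 + |r|)) • (e - r • d) ∈ Q := by
  have hpos : 0 < 1 + |r| := by positivity
  have hr := abs_le.1 (le_refl |r|)
  have e1 : 1 - 1 / (1 + |r|) = |r| * (1 / (1 + |r|)) := by field_simp; ring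
  have : u + (1 / (1 + |r|)) • (e - r • d) = (1 / (1 + |r|)) • (u + e) +
      ((|r| * (1 / (1 + |r|)) - r * (1 / (1 + |r|))) / 2) • (u + d) +
      ((|r| * (1 / (1 + |r|)) + r * (1 / (1 + |r|))) / 2) • (u - d) := by
    rw [← e1]
    module
  rw [this]
  have hc : 0 < 1 / (1 + |r|) := by positivity
  refine hQ.sum_mem (t := Finset.univ) (w := ![1 / (1 + |r|),
    (|r| * (1 / (1 + |r|)) - r * (1 / (1 + |r|))) / 2,
    (|r| * (1 / (1 + |r|)) + r * (1 / (1 + |r|))) / 2]) (z := ![u + e, u + d, u - d])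
    ?_ ?_ ?_ |> fun h => by simpa [Fin.sum_univ_three] using h
  · intro i _
    have h3 := mul_le_mul_of_nonneg_right hr.1 hc.le
    have h4 := mul_le_mul_of_nonneg_right hr.2 hc.le
    fin_cases i
    · exact hc.le
    · simp only [Fin.reduceFinMk, Matrix.cons_val]; linarith
    · simp only [Fin.reduceFinMk, Matrix.cons_val]; linarith
  · simp only [Fin.sum_univ_three, Matrix.cons_val]
    linarith
  · intro i _
    fin_cases i
    · exact he
    · exact h1
    · exact h2

/-- Strictly below `P_x` the two regions agree locally, so extremality carries over. At a vertex on
`P_x` that was not one before, no nonzero two-sided direction is parallel to `P_x`; so these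
directions form a line, which gives an old edge crossing `P_x`. -/
theorem extremePoints_region_insert (hM : 0 < M) (hX : X.Nonempty) {u : Point m} :
    u ∈ (region p M (insert x X)).extremePoints ℝ ↔
      (u ∈ (region p M X).extremePoints ℝ ∨ u ∈ newVertices p x (regionEdges p M X)) ∧
        u.2 ≤ lagrangian p x u.1 := by
  have hconv := convex_region (p := p) (M := M) hX
  constructor
  · intro hu
    have hu' := (mem_region_insert hX).1 hu.1
    refine ⟨?_, hu'.2⟩
    by_cases hext : u ∈ (region p M X).extremePoints ℝ
    · exact Or.inl hext
    rcases hu'.2.lt_or_eq with hlt | heq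
    · refine absurd ⟨hu'.1, fun q hq r hr h => ?_⟩ hext
      obtain ⟨ε, hε, -, h1⟩ := exists_pos_forall_mem_region_insert hX hu'.1 hlt hq
      obtain ⟨δ, hδ, -, h2⟩ := exists_pos_forall_mem_region_insert hX hu'.1 hlt hr
      have hm : 0 < min ε δ := lt_min hε hδ
      have h3 := hu.2 (h1 _ hm.le (min_le_left _ _)) (h2 _ hm.le (min_le_right _ _)) (by
        obtain ⟨a, b, ha, hb, hab, rfl⟩ := h
        refine ⟨a, b, ha, hb, hab, ?_⟩
        obtain rfl : b = 1 - a := by linarith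
        module)
      rw [add_eq_left, smul_eq_zero, sub_eq_zero] at h3
      exact h3.resolve_left hm.ne'
    · right
      obtain ⟨d, hd0, h1, h2⟩ := exists_direction_of_not_mem_extremePoints hconv hu'.1 hext
      have hh := height_eq_iff.2 heq
      have hzero : ∀ e, height p x e = 0 → u + e ∈ region p M X → u - e ∈ region p M X →
          e = 0 := by
        intro e he h3 h4
        have := hu.2 ((mem_region_insert hX).2 ⟨h3, height_le_iff.1 (by simp [hh, he])⟩)
          ((mem_region_insert hX).2 ⟨h4, height_le_iff.1 (by simp [hh, he])⟩)
          ⟨1 / 2, 1 / 2, by norm_num, by norm_num, by norm_num, by module⟩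
        rwa [add_eq_left] at this
      have hhd : height p x d ≠ 0 := fun h => hd0 (hzero d h h1 h2)
      obtain ⟨e, he, hue⟩ := exists_edge_of_line hM hX hd0 h1 h2 (fun e h3 h4 => by
        refine ⟨height p x e / height p x d, ?_⟩
        have h5 := hzero _ (by
          simp only [map_smul, map_sub, smul_eq_mul]
          rw [div_mul_cancel₀ _ hhd, sub_self, mul_zero])
          (add_smul_sub_smul_mem hconv h1 h2 h3 (height p x e / height p x d)) (by
            have := add_smul_sub_smul_mem hconv (d := -d) (e := -e)
              (by rwa [← sub_eq_add_neg]) (by rwa [sub_neg_eq_add])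
              (by rwa [← sub_eq_add_neg]) (height p x e / height p x d)
            convert this using 1
            module)
        rw [smul_eq_zero, sub_eq_zero] at h5
        exact h5.resolve_left (by positivity))
      have hext' := isExtreme_of_mem_regionEdges hM hX he
      refine ⟨e, he, fun hsub => hhd ?_, heq, hue⟩
      have := height_eq_iff.2 (hsub (hext'.2 h1 h2 hue
        ⟨1 / 2, 1 / 2, by norm_num, by norm_num, by norm_num, by module⟩))
      rwa [map_add, hh, add_eq_left] at this
  · rintro ⟨hu | hu, hle⟩
    · exact inter_extremePoints_subset_extremePoints_of_subset (region_insert_subset hX)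
        ⟨(mem_region_insert hX).2 ⟨hu.1, hle⟩, hu⟩
    · exact mem_extremePoints_of_mem_newVertices hM hX hu

theorem isExtreme_inter_hyperplane (hX : X.Nonempty) :
    IsExtreme ℝ (region p M (insert x X)) (region p M (insert x X) ∩ hyperplane p x) := by
  refine ⟨Set.inter_subset_left, ?_⟩
  rintro q hq r hr u ⟨-, hu⟩ ⟨a, b, ha, hb, hab, rfl⟩
  have h1 := height_le_iff.2 ((mem_region_insert hX).1 hq).2
  have h2 := height_le_iff.2 ((mem_region_insert hX).1 hr).2
  have h3 := height_eq_iff.2 hu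
  simp only [map_add, map_smul, smul_eq_mul] at h3
  obtain rfl : b = 1 - a := by linarith
  have h4 := mul_nonneg ha.le (sub_nonneg.2 h1)
  have h5 := mul_nonneg hb.le (sub_nonneg.2 h2)
  have h6 : a * (p.f x - height p x q) = 0 := by linarith
  have h6 := (mul_eq_zero.1 h6).resolve_left ha.ne'
  exact ⟨hq, height_eq_iff.1 (by linarith)⟩

theorem convex_hyperplane : Convex ℝ (hyperplane p x) := by
  have : hyperplane p x = {q | height p x q = p.f x} := by
    ext q
    exact height_eq_iff.symm
  rw [this]
  exact _root_.convex_hyperplane (height p x).isLinear _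

theorem isCompact_inter_hyperplane (hX : X.Nonempty) :
    IsCompact (region p M X ∩ hyperplane p x) := by
  have hc : Continuous fun l : Fin m → ℝ => ((l, lagrangian p x l) : Point m) :=
    continuous_id.prodMk (continuous_lagrangian p x)
  refine ((isCompact_box m M).image hc).of_isClosed_subset ?_ ?_
  · exact (isClosed_region hX).inter
      (isClosed_eq continuous_snd ((continuous_lagrangian p x).comp continuous_fst))
  · rintro ⟨l, z⟩ ⟨hq, hz⟩
    exact ⟨l, hq.1, Prod.ext rfl (Eq.symm hz)⟩

/-- The new vertices are the vertices of the facet that the cut creates. -/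
theorem newVertices_eq (hM : 0 < M) (hX : X.Nonempty) {v : Point m}
    (hv : v ∈ region p M X) (hvx : lagrangian p x v.1 < v.2) :
    newVertices p x (regionEdges p M X) =
      (region p M (insert x X) ∩ hyperplane p x).extremePoints ℝ := by
  rw [(isExtreme_inter_hyperplane hX).extremePoints_eq]
  ext u
  constructor
  · intro hu
    have := mem_extremePoints_of_mem_newVertices hM hX hu
    obtain ⟨_, _, _, hux, _⟩ := hu
    exact ⟨⟨this.1, hux⟩, this⟩
  · rintro ⟨⟨-, hux⟩, hu⟩
    rcases ((extremePoints_region_insert hM hX).1 hu).1 with h | h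
    · obtain ⟨e, he, hne, hue⟩ := exists_edge_not_subset hM hX h hux hv hvx
      exact ⟨e, he, hne, hux, hue⟩
    · exact h

/-- Krein–Milman on the compact facet; no closure is needed because the vertices are finitely many.
-/
theorem convexHull_newVertices (hM : 0 < M) (hX : X.Nonempty) {v : Point m}
    (hv : v ∈ region p M X) (hvx : lagrangian p x v.1 < v.2) :
    convexHull ℝ (newVertices p x (regionEdges p M X)) =
      region p M (insert x X) ∩ hyperplane p x := by
  have hX' : (insert x X).Nonempty := Set.insert_nonempty _ _
  have hfin : (newVertices p x (regionEdges p M X)).Finite :=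
    (finite_extremePoints_region hX').subset fun u hu =>
      mem_extremePoints_of_mem_newVertices hM hX hu
  rw [← hfin.isClosed_convexHull ℝ |>.closure_eq, newVertices_eq hM hX hv hvx]
  exact closure_convexHull_extremePoints (isCompact_inter_hyperplane hX')
    ((convex_region hX').inter convex_hyperplane)

/-- The facet is extreme in the cut region, so its edges are the bounded edges of the region that
lie in it. -/
theorem mem_convEdge_newVertices (hM : 0 < M) (hX : X.Nonempty) {v : Point m}
    (hv : v ∈ region p M X) (hvx : lagrangian p x v.1 < v.2) {e : Set (Point m)} :
    e ∈ convEdge (newVertices p x (regionEdges p M X)) ↔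
      e ∈ segmentEdges (region p M (insert x X)) ∧ e ⊆ hyperplane p x := by
  have hX' : (insert x X).Nonempty := Set.insert_nonempty _ _
  have hext := isExtreme_inter_hyperplane (p := p) (M := M) (x := x) hX
  rw [convEdge, convexHull_newVertices hM hX hv hvx,
    mem_segmentEdges ((convex_region hX').inter convex_hyperplane),
    mem_segmentEdges (convex_region hX')]
  constructor
  · rintro ⟨a, ha, b, hb, hab, he, h⟩
    exact ⟨⟨a, hext.extremePoints_subset_extremePoints ha, b,
      hext.extremePoints_subset_extremePoints hb, hab, he, hext.trans h⟩,
      h.1.trans Set.inter_subset_right⟩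
  · rintro ⟨⟨a, ha, b, hb, hab, he, h⟩, hsub⟩
    have hsub' := Set.subset_inter h.1 hsub
    rw [hext.extremePoints_eq]
    exact ⟨a, ⟨hsub' (he ▸ left_mem_segment ℝ a b), ha⟩, b,
      ⟨hsub' (he ▸ right_mem_segment ℝ a b), hb⟩, hab, he,
      h.mono Set.inter_subset_left hsub'⟩

/-! ### Edges after a cut -/

/-- The part of a crossing segment below the hyperplane. -/
theorem mem_segment_crossing {a b c q : Point m} (ha : a.2 ≤ lagrangian p x a.1)
    (hb : lagrangian p x b.1 < b.2) (hc : c ∈ segment ℝ a b) (hcx : c ∈ hyperplane p x)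
    (hq : q ∈ segment ℝ a b) (hqx : q.2 ≤ lagrangian p x q.1) : q ∈ segment ℝ a c := by
  rw [segment_eq_image'] at hc hq ⊢
  obtain ⟨s, hs, rfl⟩ := hc
  obtain ⟨t, ht, rfl⟩ := hq
  have h1 := height_le_iff.2 ha
  have h2 := lt_height_iff.2 hb
  have h3 := height_eq_iff.2 hcx
  have h4 := height_le_iff.2 hqx
  simp only [map_add, map_smul, map_sub, smul_eq_mul] at h3 h4
  have hts : t ≤ s := by
    by_contra! h
    have := mul_pos (sub_pos.2 h) (show 0 < height p x b - height p x a by linarith)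
    linarith
  rcases hs.1.eq_or_lt with h | h
  · exact ⟨0, by simp, by simp [show t = 0 by linarith [ht.1]]⟩
  · refine ⟨t / s, ⟨div_nonneg ht.1 h.le, (div_le_one h).2 hts⟩, ?_⟩
    simp only [add_sub_cancel_left, smul_smul]
    rw [div_mul_cancel₀ _ h.ne']

theorem exists_crossing {a b : Point m} (ha : a.2 ≤ lagrangian p x a.1)
    (hb : lagrangian p x b.1 < b.2) : ∃ c, segment ℝ a b ∩ hyperplane p x = {c} := by
  have h1 := height_le_iff.2 ha
  have h2 := lt_height_iff.2 hb
  have hpos : 0 < height p x b - height p x a := by linarith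
  refine ⟨a + ((p.f x - height p x a) / (height p x b - height p x a)) • (b - a),
    Set.eq_singleton_iff_unique_mem.2 ⟨⟨?_, height_eq_iff.1 ?_⟩, ?_⟩⟩
  · rw [segment_eq_image']
    exact ⟨_, ⟨div_nonneg (by linarith) hpos.le, (div_le_one hpos).2 (by linarith)⟩, rfl⟩
  · simp only [map_add, map_smul, map_sub, smul_eq_mul]
    rw [div_mul_cancel₀ _ hpos.ne']
    ring
  · rintro q ⟨hq, hqx⟩
    rw [segment_eq_image'] at hq
    obtain ⟨t, -, rfl⟩ := hq
    have h3 := height_eq_iff.2 hqx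
    simp only [map_add, map_smul, map_sub, smul_eq_mul] at h3
    have : t = (p.f x - height p x a) / (height p x b - height p x a) := by
      rw [eq_div_iff hpos.ne']; linarith
    rw [this]

/-- Every edge that gets removed has a point above the hyperplane. -/
theorem exists_above_of_mem_cutEdges {V : Set (Point m)} {E : Set (Set (Point m))}
    {e : Set (Point m)} (he : e ∈ cutEdges (cutVertices p x V) E) :
    ∃ q ∈ e, lagrangian p x q.1 < q.2 := by
  rcases he.2 with ⟨a, b, rfl, h | h⟩ | ⟨u, hu, rfl⟩
  · exact ⟨a, left_mem_segment _ _ _, h.2⟩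
  · exact ⟨b, right_mem_segment _ _ _, h.2⟩
  · exact ⟨u, ⟨rfl, le_rfl⟩, hu.2⟩

theorem updatedEdges_subset (hM : 0 < M) (hX : X.Nonempty) {v : Point m}
    (hv : v ∈ region p M X) (hvx : lagrangian p x v.1 < v.2) :
    updatedEdges p x ((region p M X).extremePoints ℝ) (regionEdges p M X) ⊆
      regionEdges p M (insert x X) := by
  have hX' : (insert x X).Nonempty := Set.insert_nonempty _ _
  have hconv' := convex_region (p := p) (M := M) hX'
  have hsubset := region_insert_subset (p := p) (M := M) (x := x) hX
  rintro e ⟨(he | he) | he, hcut⟩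
  · rcases (mem_regionEdges hM hX).1 he with ⟨a, ha, b, hb, hab, rfl, hext⟩ | ⟨l, hl, rfl⟩
    · have ha' : a.2 ≤ lagrangian p x a.1 := by
        by_contra! h
        exact hcut ⟨he, Or.inl ⟨a, b, rfl, Or.inl ⟨ha, h⟩⟩⟩
      have hb' : b.2 ≤ lagrangian p x b.1 := by
        by_contra! h
        exact hcut ⟨he, Or.inl ⟨a, b, rfl, Or.inr ⟨hb, h⟩⟩⟩
      have ha'' := (extremePoints_region_insert hM hX).2 ⟨Or.inl ha, ha'⟩
      have hb'' := (extremePoints_region_insert hM hX).2 ⟨Or.inl hb, hb'⟩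
      exact (mem_regionEdges hM hX').2 (Or.inl ⟨a, ha'', b, hb'', hab, rfl,
        hext.mono hsubset (hconv'.segment_subset ha''.1 hb''.1)⟩)
    · have h : inducedDual p X l ≤ lagrangian p x l := by
        by_contra! h
        exact hcut ⟨he, Or.inr ⟨_, ⟨corner_mem_extremePoints hM hl, h⟩, rfl⟩⟩
      refine (mem_regionEdges hM hX').2 (Or.inr ⟨l, hl, ?_⟩)
      rw [inducedDual_insert hX, min_eq_left h]
  · exact Or.inl ((mem_convEdge_newVertices hM hX hv hvx).1 he).1
  · rcases he with ⟨a, b, c, hmem, ha, hc, hac, rfl⟩ | ⟨u, c, hmem, hc, rfl⟩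
    · obtain ⟨haX, hbX, hab⟩ := segment_mem_regionEdges hM hX hmem.1
      have ha' : a.2 ≤ lagrangian p x a.1 := not_lt.1 fun h => ha ⟨haX, h⟩
      have hcmem : c ∈ segment ℝ a b ∩ hyperplane p x := by rw [hc]; rfl
      -- The cut vertex may come from another description of the same segment, but it is a vertex on
      -- it, hence `a` or `b`, and `a` survives.
      have hb' : lagrangian p x b.1 < b.2 := by
        by_contra! hb
        have : ∀ w ∈ (region p M X).extremePoints ℝ, w ∈ segment ℝ a b →
            w.2 ≤ lagrangian p x w.1 := by
          intro w hw hwab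
          rcases eq_or_eq_of_mem_segment hw haX.1 hbX.1 hwab with rfl | rfl
          exacts [ha', hb]
        rcases hmem.2 with ⟨r, s, hrs, h | h⟩ | ⟨u, -, hu⟩
        · exact (this r h.1 (hrs ▸ left_mem_segment ℝ r s)).not_gt h.2
        · exact (this s h.1 (hrs ▸ right_mem_segment ℝ r s)).not_gt h.2
        · exact downRay_ne_segment _ _ _ hu.symm
      have hext := isExtreme_of_mem_regionEdges hM hX hmem.1
      have ha'' := (extremePoints_region_insert hM hX).2 ⟨Or.inl haX, ha'⟩
      have hc'' : c ∈ (region p M (insert x X)).extremePoints ℝ :=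
        mem_extremePoints_of_mem_newVertices hM hX
          ⟨_, hmem.1, fun h => hb'.ne' (h (right_mem_segment _ _ _)), hcmem.2, hcmem.1⟩
      have heq : segment ℝ a c = segment ℝ a b ∩ region p M (insert x X) := by
        apply Set.Subset.antisymm
        · exact Set.subset_inter
            ((convex_segment a b).segment_subset (left_mem_segment _ _ _) hcmem.1)
            (hconv'.segment_subset ha''.1 hc''.1)
        · rintro q ⟨hq, hq'⟩
          exact mem_segment_crossing ha' hb' hcmem.1 hcmem.2 hq ((mem_region_insert hX).1 hq').2
      exact (mem_regionEdges hM hX').2 (Or.inl ⟨a, ha'', c, hc'', hac, rfl,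
        heq ▸ isExtreme_inter_of_subset hext hsubset⟩)
    · obtain ⟨hu, hu2⟩ := downRay_mem_regionEdges hM hX hmem.1
      have hcmem : c ∈ downRay u ∩ hyperplane p x := by rw [hc]; rfl
      have hc1 : c.1 = u.1 := hcmem.1.1
      have hc2 : c.2 = lagrangian p x c.1 := hcmem.2
      have hc3 := hcmem.1.2
      refine (mem_regionEdges hM hX').2 (Or.inr ⟨u.1, hu, ?_⟩)
      congr 1
      refine Prod.ext hc1 ?_
      rw [inducedDual_insert hX, ← hu2, ← hc1, ← hc2, min_eq_right hc3]

/-- For a bounded edge not inside `P_x`, the midpoint `y` is strictly below `P_x`. Two-sided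
directions at `y` in the old region, once shrunk, are available in the new one, hence parallel to
the edge. So `y` lies on an old edge `e₀`, which contains `a` and `b`; it is kept or shortened
according to its end points. -/
theorem subset_updatedEdges (hM : 0 < M) (hX : X.Nonempty) {v : Point m}
    (hv : v ∈ region p M X) (hvx : lagrangian p x v.1 < v.2) :
    regionEdges p M (insert x X) ⊆
      updatedEdges p x ((region p M X).extremePoints ℝ) (regionEdges p M X) := by
  have hX' : (insert x X).Nonempty := Set.insert_nonempty _ _
  have hconv := convex_region (p := p) (M := M) hX
  have hsubset := region_insert_subset (p := p) (M := M) (x := x) hX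
  intro e he
  refine ⟨?_, fun hcut => ?_⟩
  swap
  · obtain ⟨q, hq, hqx⟩ := exists_above_of_mem_cutEdges hcut
    exact ((mem_region_insert hX).1
      ((isExtreme_of_mem_regionEdges hM hX' he).1 hq)).2.not_gt hqx
  rcases (mem_regionEdges hM hX').1 he with ⟨a, ha, b, hb, hab, rfl, hext⟩ | ⟨l, hl, rfl⟩
  · by_cases hsub : segment ℝ a b ⊆ hyperplane p x
    · refine Or.inl (Or.inr ((mem_convEdge_newVertices hM hX hv hvx).2 ⟨?_, hsub⟩))
      exact (mem_segmentEdges (convex_region hX')).2 ⟨a, ha, b, hb, hab, rfl, hext⟩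
    set d : Point m := (1 / 2 : ℝ) • (b - a) with hd
    set y : Point m := (1 / 2 : ℝ) • (a + b) with hy
    have hyd : y + d = b := by rw [hy, hd]; module
    have hyd' : y - d = a := by rw [hy, hd]; module
    have hd0 : d ≠ 0 := smul_ne_zero (by norm_num) (sub_ne_zero.2 hab.symm)
    have hyab : y ∈ openSegment ℝ a b :=
      ⟨1 / 2, 1 / 2, by norm_num, by norm_num, by norm_num, by rw [hy]; module⟩
    have haX := (mem_region_insert hX).1 ha.1
    have hbX := (mem_region_insert hX).1 hb.1
    have hyX := (mem_region_insert hX).1 (hext.1 (openSegment_subset_segment _ _ _ hyab))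
    have hylt : y.2 < lagrangian p x y.1 := by
      refine lt_of_le_of_ne hyX.2 fun h => hsub ?_
      have hh := isExtreme_inter_hyperplane (p := p) (M := M) (x := x) hX
      have hyF : y ∈ region p M (insert x X) ∩ hyperplane p x :=
        ⟨(mem_region_insert hX).2 hyX, h⟩
      exact convex_hyperplane.segment_subset (hh.2 ha.1 hb.1 hyF hyab).2
        (hh.right_mem_of_mem_openSegment ha.1 hb.1 hyF hyab).2
    obtain ⟨e₀, he₀, hye₀⟩ := exists_edge_of_line hM hX hd0 (by rw [hyd]; exact hbX.1)
      (by rw [hyd']; exact haX.1) (fun e h1 h2 => by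
        obtain ⟨ε, hε, -, h3⟩ := exists_pos_forall_mem_region_insert hX hyX.1 hylt h1
        obtain ⟨δ, hδ, -, h4⟩ := exists_pos_forall_mem_region_insert hX hyX.1 hylt h2
        have hm : 0 < min ε δ := lt_min hε hδ
        have h5 := hext.2 (h3 _ hm.le (min_le_left _ _)) (h4 _ hm.le (min_le_right _ _))
          (openSegment_subset_segment _ _ _ hyab)
          ⟨1 / 2, 1 / 2, by norm_num, by norm_num, by norm_num, by module⟩
        rw [segment_eq_image'] at h5
        obtain ⟨t, -, ht⟩ := h5
        refine ⟨(2 * t - 1) / min ε δ, ?_⟩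
        have h6 : min ε δ • e = (2 * t - 1) • d := by
          have : min ε δ • e = (y + min ε δ • (y + e - y)) - y := by module
          rw [this, ← ht, hy, hd]
          module
        rw [div_eq_inv_mul, mul_smul, ← h6, inv_smul_smul₀ hm.ne'])
    have hext₀ := isExtreme_of_mem_regionEdges hM hX he₀
    have hae₀ := hext₀.2 haX.1 hbX.1 hye₀ hyab
    have hbe₀ := hext₀.right_mem_of_mem_openSegment haX.1 hbX.1 hye₀ hyab
    rcases (mem_regionEdges hM hX).1 he₀ with ⟨r, hr, s, hs, hrs, rfl, -⟩ | ⟨l, hl, rfl⟩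
    · have hcross : ∀ r s, r ∈ (region p M X).extremePoints ℝ →
          s ∈ (region p M X).extremePoints ℝ → segment ℝ r s ∈ regionEdges p M X →
          a ∈ segment ℝ r s → b ∈ segment ℝ r s → y ∈ segment ℝ r s →
          r.2 ≤ lagrangian p x r.1 → lagrangian p x s.1 < s.2 →
          segment ℝ a b ∈ shortenedEdges p x (cutVertices p x ((region p M X).extremePoints ℝ))
            (cutEdges (cutVertices p x ((region p M X).extremePoints ℝ))
              (regionEdges p M X)) := by
        intro r s hr hs hrsE har hbr hyr hrx hsx
        obtain ⟨c, hc⟩ := exists_crossing hrx hsx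
        have hcmem : c ∈ segment ℝ r s ∩ hyperplane p x := by rw [hc]; rfl
        have ha' := mem_segment_crossing hrx hsx hcmem.1 hcmem.2 har haX.2
        have hb' := mem_segment_crossing hrx hsx hcmem.1 hcmem.2 hbr hbX.2
        refine Or.inl ⟨r, s, c, ⟨hrsE, Or.inl ⟨r, s, rfl, Or.inr ⟨hs, hsx⟩⟩⟩,
          fun h => hrx.not_gt h.2, hc, ?_, ?_⟩
        · rintro rfl
          rw [segment_same] at ha' hb'
          exact hab (ha'.trans hb'.symm)
        · exact segment_eq_of_mem ha hb hab ((mem_region_insert hX).2 ⟨hr.1, hrx⟩)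
            ((mem_region_insert hX).2
              ⟨hconv.segment_subset hr.1 hs.1 hcmem.1, hcmem.2.le⟩) ha' hb'
      rcases le_or_gt r.2 (lagrangian p x r.1) with hrx | hrx <;>
        rcases le_or_gt s.2 (lagrangian p x s.1) with hsx | hsx
      · refine Or.inl (Or.inl ?_)
        rw [segment_eq_of_mem ha hb hab ((mem_region_insert hX).2 ⟨hr.1, hrx⟩)
          ((mem_region_insert hX).2 ⟨hs.1, hsx⟩) hae₀ hbe₀]
        exact he₀
      · exact Or.inr (hcross r s hr hs he₀ hae₀ hbe₀ hye₀ hrx hsx)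
      · rw [segment_symm] at he₀ hae₀ hbe₀ hye₀
        exact Or.inr (hcross s r hs hr he₀ hae₀ hbe₀ hye₀ hsx hrx)
      · exfalso
        have h1 := lt_height_iff.2 hrx
        have h2 := lt_height_iff.2 hsx
        have h3 := (convex_halfSpace_gt (height p x).isLinear (p.f x)).segment_subset h1 h2 hye₀
        exact hylt.not_gt (lt_height_iff.1 h3)
    -- If `e₀` were a ray, the vertices `a` and `b` would lie over the same corner, hence coincide.
    · refine absurd (Prod.ext (hae₀.1.trans hbe₀.1.symm) ?_) hab
      rw [snd_eq_of_mem_extremePoints ha, snd_eq_of_mem_extremePoints hb, hae₀.1, hbe₀.1]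
  · have hmem : downRay (l, inducedDual p X l) ∈ regionEdges p M X :=
      (mem_regionEdges hM hX).2 (Or.inr ⟨l, hl, rfl⟩)
    rw [inducedDual_insert hX]
    rcases le_or_gt (inducedDual p X l) (lagrangian p x l) with h | h
    · rw [min_eq_left h]
      exact Or.inl (Or.inl hmem)
    · rw [min_eq_right h.le]
      refine Or.inr (Or.inr ⟨_, (l, lagrangian p x l), ⟨hmem, Or.inr ⟨_,
        ⟨corner_mem_extremePoints hM hl, h⟩, rfl⟩⟩, ?_, rfl⟩)
      refine Set.eq_singleton_iff_unique_mem.2 ⟨⟨⟨rfl, h.le⟩, rfl⟩, ?_⟩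
      rintro ⟨l', z⟩ ⟨⟨h1, -⟩, h2⟩
      obtain rfl : l' = l := h1
      exact Prod.ext rfl h2

/-- Updating the edges after a cut gives the edges of the skeleton of the smaller dual. -/
theorem updatedEdges_eq (hM : 0 < M) (hX : X.Nonempty) {v : Point m}
    (hv : v ∈ region p M X) (hvx : lagrangian p x v.1 < v.2) :
    updatedEdges p x ((region p M X).extremePoints ℝ) (regionEdges p M X) =
      regionEdges p M (insert x X) :=
  (updatedEdges_subset hM hX hv hvx).antisymm (subset_updatedEdges hM hX hv hvx)

end Cutting

/-! ### Loop invariant and termination -/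

section Invariant

variable {n m : ℕ} {p : Problem n m} {M : ℝ} {X : Set (Fin n → Bool)}

theorem extremePoints_region_singleton (hM : 0 < M) {x : Fin n → Bool} {u : Point m} :
    u ∈ (region p M {x}).extremePoints ℝ ↔ u.1 ∈ corners m M ∧ u.2 = lagrangian p x u.1 := by
  have hdual : ∀ l, inducedDual p {x} l = lagrangian p x l := fun l => by
    refine eq_of_forall_le_iff fun z => ?_
    rw [le_inducedDual_iff (Set.singleton_nonempty x)]
    simp
  constructor
  · intro hu
    have h2 := snd_eq_of_mem_extremePoints hu
    rw [hdual] at h2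
    refine ⟨?_, h2⟩
    by_contra hc
    obtain ⟨d, hd0, h3, h4⟩ := exists_perturbation hu.1.1 hc
    have hadd : lagrangian p x (u.1 + d) + lagrangian p x (u.1 - d) =
        2 * lagrangian p x u.1 := by
      simp only [lagrangian, Pi.add_apply, Pi.sub_apply, add_mul, sub_mul, Finset.sum_add_distrib,
        Finset.sum_sub_distrib]
      ring
    have := hu.2 (x₁ := (u.1 + d, lagrangian p x (u.1 + d))) ⟨h3, (hdual _).ge⟩
      (x₂ := (u.1 - d, lagrangian p x (u.1 - d))) ⟨h4, (hdual _).ge⟩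
      ⟨1 / 2, 1 / 2, by norm_num, by norm_num, by norm_num, by
        ext1
        · simp only [Prod.fst_add, Prod.smul_fst]; module
        · simp only [Prod.snd_add, Prod.smul_snd, smul_eq_mul]; linarith⟩
    have := congrArg Prod.fst this
    simp only [add_eq_left] at this
    exact hd0 this
  · rintro ⟨hc, h2⟩
    have : u = (u.1, inducedDual p {x} u.1) := Prod.ext rfl (by rw [hdual, h2])
    rw [this]
    exact corner_mem_extremePoints hM hc

/-- If all vertices of `Γ_X` lie below every `P_x`, so does all of `Γ_X`. -/
theorem region_subset_of_vertices (hX : X.Nonempty)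
    (h : ∀ u ∈ (region p M X).extremePoints ℝ, u.2 ≤ dual p u.1) {q : Point m}
    (hq : q ∈ region p M X) : q.2 ≤ dual p q.1 := by
  by_contra! hlt
  obtain ⟨x, hx⟩ := (dual_isLeast p q.1).1
  rw [← hx] at hlt
  have hlt : p.f x < height p x q := lt_height_iff.2 hlt
  -- The region is unbounded below; its part on or above `P_x` is compact, so a maximal height
  -- exists.
  let K := region p M X ∩ {r | p.f x ≤ height p x r}
  have hcont : Continuous (height p x) := (height p x).continuous_of_finiteDimensional
  have hKc : IsCompact K := by
    obtain ⟨x₀, hx₀⟩ := hX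
    obtain ⟨B, hB⟩ := (isCompact_box m M).bddAbove_image
      (continuous_lagrangian p x₀).continuousOn
    obtain ⟨A, hA⟩ := (isCompact_box m M).bddBelow_image
      (continuous_lagrangian p x).continuousOn
    refine ((isCompact_box m M).prod (isCompact_Icc (a := A) (b := B))).of_isClosed_subset
      ((isClosed_region ⟨x₀, hx₀⟩).inter (isClosed_le continuous_const hcont)) ?_
    rintro r ⟨hr, hrx⟩
    refine ⟨hr.1, ?_, ?_⟩
    · refine (hA ⟨r.1, hr.1, rfl⟩).trans (not_lt.1 fun hlt' => ?_)
      exact (height_le_iff.2 hlt'.le).antisymm hrx |> fun h => hlt'.ne (height_eq_iff.1 h)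
    · exact (((mem_region ⟨x₀, hx₀⟩).1 hr).2 x₀ hx₀).trans (hB ⟨r.1, hr.1, rfl⟩)
  obtain ⟨r, hr, hmax⟩ := hKc.exists_isMaxOn ⟨q, hq, hlt.le⟩ hcont.continuousOn
  have hrpos : p.f x < height p x r := hlt.trans_le (hmax ⟨hq, hlt.le⟩)
  have hmax' : ∀ s ∈ region p M X, height p x s ≤ height p x r := fun s hs => by
    rcases le_or_gt (p.f x) (height p x s) with h | h
    · exact hmax ⟨hs, h⟩
    · exact h.le.trans hrpos.le
  -- The face of maximal height is compact and extreme, so it contains a vertex of the region, which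
  -- lies above `P_x`.
  let F := region p M X ∩ {s | height p x s = height p x r}
  have hF : IsExtreme ℝ (region p M X) F := by
    refine ⟨Set.inter_subset_left, ?_⟩
    rintro s hs t ht _ ⟨-, h3⟩ ⟨a, b, ha, hb, hab, rfl⟩
    have h1 := hmax' s hs
    have h2 := hmax' t ht
    simp only [Set.mem_ofPred_eq, map_add, map_smul, smul_eq_mul] at h3
    obtain rfl : b = 1 - a := by linarith
    have h4 := mul_nonneg ha.le (sub_nonneg.2 h1)
    have h5 := mul_nonneg hb.le (sub_nonneg.2 h2)
    have h6 : a * (height p x r - height p x s) = 0 := by linarith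
    have h6 := (mul_eq_zero.1 h6).resolve_left ha.ne'
    exact ⟨hs, show height p x s = height p x r by linarith⟩
  have hFc : IsCompact F := hKc.of_isClosed_subset
    ((isClosed_region hX).inter (isClosed_eq hcont continuous_const))
    fun s hs => ⟨hs.1, show p.f x ≤ height p x s by rw [hs.2]; exact hrpos.le⟩
  obtain ⟨u, hu⟩ := hFc.extremePoints_nonempty ⟨r, hr.1, rfl⟩
  have h1 := h u (hF.extremePoints_subset_extremePoints hu)
  have h2 : height p x u = height p x r := hu.1.2
  rw [← h2] at hrpos
  exact (lt_height_iff.1 hrpos).not_ge (h1.trans ((dual_isLeast p u.1).2 ⟨x, rfl⟩))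

/-- The invariant of the loop: the graph is the skeleton of `g_X`, and the processed vertices are
on the graph of the full dual. -/
structure Invariant (p : Problem n m) (M : ℝ) (s : State n m) : Prop where
  nonempty : s.X.Nonempty
  vertices_eq : s.V = (region p M s.X).extremePoints ℝ
  edges_eq : s.E = regionEdges p M s.X
  processed_le : ∀ u ∈ s.processed, u.2 ≤ dual p u.1

theorem invariant_of_isInitial (hM : 0 < M) {O : (Fin m → ℝ) → (Fin n → Bool)} {s : State n m}
    (h : IsInitial p M O s) : Invariant p M s := by
  obtain ⟨l, -, hX, hproc, -, hpend, hE⟩ := h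
  refine ⟨by rw [hX]; exact Set.singleton_nonempty _, ?_, hE, by simp [hproc]⟩
  ext u
  rw [hX, extremePoints_region_singleton hM, ← hpend]
  simp [State.V, hproc]

theorem mem_removeAbove {x : Fin n → Bool} {l : List (Point m)} {u : Point m} :
    u ∈ removeAbove p x l ↔ u ∈ l ∧ u.2 ≤ lagrangian p x u.1 := by
  simp [removeAbove]

theorem Invariant.step (hM : 0 < M) {O : (Fin m → ℝ) → (Fin n → Bool)} (hO : IsOracle p M O)
    {s t : State n m} (hs : Invariant p M s) (h : Step p O s t) : Invariant p M t := by
  cases h with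
  | confirm v rest hv htest =>
    have hmem : v ∈ s.V := by simp [State.V, hv]
    rw [hs.vertices_eq] at hmem
    refine ⟨hs.nonempty, ?_, hs.edges_eq, ?_⟩
    · rw [← hs.vertices_eq]
      ext u
      simp [State.V, hv]
    · intro u hu
      rcases List.mem_append.1 hu with hu | hu
      · exact hs.processed_le u hu
      · obtain rfl := List.mem_singleton.1 hu
        obtain ⟨x, hx⟩ := (dual_isLeast p u.1).1
        rw [← hx]
        exact (not_lt.1 htest).trans (hO _ hmem.1.1 x)
  | cut v rest new hv htest hnodup hnew =>
    have hmem : v ∈ s.V := by simp [State.V, hv]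
    rw [hs.vertices_eq] at hmem
    refine ⟨Set.insert_nonempty _ _, ?_, ?_, ?_⟩
    · ext u
      rw [extremePoints_region_insert hM hs.nonempty, ← hs.vertices_eq, ← hs.edges_eq]
      have hV : u ∈ s.V ↔ u ∈ s.processed ∨ u = v ∨ u ∈ rest := by simp [State.V, hv]
      have hl : u ∈ State.V ⟨insert (O v.1) s.X,
          removeAbove p (O v.1) (s.processed ++ [v]), removeAbove p (O v.1) (rest ++ new),
          updatedEdges p (O v.1) s.V s.E⟩ ↔
          (u ∈ s.V ∨ u ∈ new) ∧ u.2 ≤ lagrangian p (O v.1) u.1 := by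
        rw [hV]
        simp only [State.V, Set.mem_ofPred_eq, List.mem_append, mem_removeAbove,
          List.mem_singleton]
        tauto
      rw [hl, hnew]
      tauto
    · simp only
      rw [hs.vertices_eq, hs.edges_eq]
      exact updatedEdges_eq hM hs.nonempty hmem.1 htest
    · intro u hu
      obtain ⟨hu, hux⟩ := mem_removeAbove.1 hu
      rcases List.mem_append.1 hu with hu | hu
      · exact hs.processed_le u hu
      · obtain rfl := List.mem_singleton.1 hu
        -- The vertex `v` that triggered the cut is above the new hyperplane, so it does not survive
        -- among the processed ones.
        exact absurd htest hux.not_gt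

/-- Every minimizer at every `λ` belongs to `χ_g` by definition, so the second equality of the
theorem is the first one. -/
theorem inducedDual_charSet (p : Problem n m) : inducedDual p (charSet p) = dual p := by
  funext l
  refine eq_of_forall_le_iff fun z => ?_
  rw [le_inducedDual_iff (charSet_nonempty p)]
  constructor
  · intro h
    obtain ⟨x, hx⟩ := (dual_isLeast p l).1
    rw [← hx]
    refine h x (Set.mem_iUnion.2 ⟨l, fun y => ?_⟩)
    exact (show lagrangian p x l = dual p l from hx).trans_le ((dual_isLeast p l).2 ⟨y, rfl⟩)
  · exact fun h x _ => h.trans ((dual_isLeast p l).2 ⟨x, rfl⟩)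

/-- Only hypographs over the box are compared: outside `S` the function `g_X` may exceed `g`. -/
theorem hypograph_dual_eq (hX : X.Nonempty)
    (h : ∀ u ∈ (region p M X).extremePoints ℝ, u.2 ≤ dual p u.1) :
    hypograph M (dual p) = hypograph M (inducedDual p X) := by
  apply Set.Subset.antisymm
  · exact fun q hq => (mem_region hX).2
      ⟨hq.1, fun x _ => hq.2.trans ((dual_isLeast p q.1).2 ⟨x, rfl⟩)⟩
  · exact fun q hq => ⟨hq.1, region_subset_of_vertices hX h hq⟩

theorem graph_eq_skeleton (hM : 0 < M) {O : (Fin m → ℝ) → (Fin n → Bool)} (hO : IsOracle p M O)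
    {s : State n m} (hs : TerminatesIn p M O s) : s.graph = skeleton M (dual p) := by
  obtain ⟨s₀, h₀, hsteps, hpend⟩ := hs
  have hinv : Invariant p M s := by
    clear hpend
    induction hsteps with
    | refl => exact invariant_of_isInitial hM h₀
    | tail _ h ih => exact ih.step hM hO h
  have hhyp := hypograph_dual_eq hinv.nonempty (p := p) (M := M) fun u hu => by
    rw [← hinv.vertices_eq] at hu
    refine hinv.processed_le u ?_
    simpa [State.V, hpend] using hu
  rw [State.graph, hinv.vertices_eq, hinv.edges_eq, ← skeletonVertices_eq hinv.nonempty]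
  simp only [skeleton, regionEdges, skeletonEdges, skeletonVertices, hhyp]

end Invariant

end DualSearch

theorem mainTheorem4 {n m : ℕ} (p : DualSearch.Problem n m) (M : ℝ) (hM : 0 < M)
    (O : (Fin m → ℝ) → (Fin n → Bool)) (hO : DualSearch.IsOracle p M O)
    (s : DualSearch.State n m) (hs : DualSearch.TerminatesIn p M O s) :
    s.graph = DualSearch.skeleton M (DualSearch.dual p) ∧
      s.graph = DualSearch.skeleton M (DualSearch.inducedDual p (DualSearch.charSet p)) := by
  rw [DualSearch.inducedDual_charSet, and_self]
  exact DualSearch.graph_eq_skeleton hM hO hs
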